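/- Let $\phi$ be a Bernstein function, $\phi(u)=\mathsf k+\mathsf d u+\int_0^\infty(1-e^{-uy})\,\mu(dy)$ for $u\ge 0$, where $\mathsf k,\mathsf d\ge 0$ and $\mu$ is a measure on $(0,\infty)$ with $\int_0^\infty (1\wedge y)\,\mu(dy)<\infty$, and assume $\phi\not\equiv 0$. The same formula extends $\phi$ to $\{\operatorname{Re} z\ge 0\}$. Let $$\gamma_\phi=\lim_{n\to\infty}\Big(\sum_{k=1}^n\frac{\phi'(k)}{\phi(k)}-\log\phi(n)\Big),\qquad W_\phi(z)=\frac{e^{-\gamma_\phi z}}{\phi(z)}\prod_{k=1}^\infty\frac{\phi(k)}{\phi(k+z)}\,e^{\frac{\phi'(k)}{\phi(k)}z},\quad \operatorname{Re} z>0 .$$ The limit exists and the product converges absolutely. Moreover $W_\phi$ is analytic and zero-free on $\{\operatorname{Re} z>0\}$ with $W_\phi(1)=1$, so it has a unique analytic logarithm $\log W_\phi$ there with $\log W_\phi(1)=0$; for $t>0$ put $W_\phi^t(z)=e^{t\log W_\phi(z)}$, and $\phi^t(z)=e^{t\operatorname{Log}\phi(z)}$ with the principal logarithm. The Berg-Urbanik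 semigroup associated to $\phi$ is the semigroup $(\nu_t)_{t\ge0}$, under product convolution ($\nu_s\diamond\nu_t=\nu_{s+t}$), of probability measures on $[0,\infty)$ such that, for $t\ge 0$ and $\operatorname{Re} z>0$, $\int x^z\,\nu_t(dx)=e^{t\Psi(z)}$, where $$\Psi(z)=z\log\phi(1)+\int_0^\infty\big(e^{-zy}-1-z(e^{-y}-1)\big)\frac{\kappa(dy)}{y(e^y-1)}$$ and $\kappa$ is the measure on $(0,\infty)$ with $\int_0^\infty e^{-uy}\kappa(dy)=\phi'(u)/\phi(u)$ for all $u>0$. Theorem. (1) If $(\nu_t)_{t\ge 0}$ is the Berg-Urbanik semigroup associated to $\phi$, then for every $t>0$ and every $z$ with $\operatorname{Re} z>-1$, the integral $\int_0^\infty x^z\,\nu_t(dx)$ converges absolutely and $$\int_0^\infty x^z\,\nu_t(dx)=W_\phi^t(z+1).$$ (2) For every $t>0$, $W_\phi^t$ is analytic on $\{\operatorname{Re} z>0\}$ and satisfies $W_\phi^t(z+1)=\phi^t(z)\,W_\phi^t(z)$ for $\operatorname{Re} z>0$, and $W_\phi^t(1)=1$. (3) Call an analytic function $G$ on $\{\operatorname{Re}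 z>0\}$ positive-definite if $\sum_{i,j=1}^n G(1+s_i-s_j)\,c_i\overline{c_j}\ge 0$ for all $n$, all $s_1,\dots,s_n\in i\mathbb R$ and all $c_1,\dots,c_n\in\mathbb C$. Then $W_\phi$ is positive-definite, and it is the only positive-definite analytic function $G$ on $\{\operatorname{Re} z>0\}$ with $G(z+1)=\phi(z)G(z)$ for $\operatorname{Re} z>0$ and $G(1)=1$; in particular it is the only one whose powers $G^t$ solve the equation in (2) for all $t>0$. -/

import Mathlib

open MeasureTheory Filter Topology Set
open scoped NNReal ENNReal

/-- A Bernstein function, given by its (unique) triplet: killing `k ≥ 0`, drift `d ≥ 0`, and a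
Lévy measure `μ` carried by `(0, ∞)` with `∫ min(1, y) μ(dy) < ∞` (so `μ` is finite on compact
subsets of `(0, ∞)`). -/
structure BernsteinFunction where
  killing : ℝ
  drift : ℝ
  levy : Measure ℝ
  killing_nonneg : 0 ≤ killing
  drift_nonneg : 0 ≤ drift
  levy_Iic : levy (Iic 0) = 0
  levy_int : ∫⁻ y, ENNReal.ofReal (min 1 y) ∂levy < ∞

namespace BernsteinFunction

/-- `φ(u) = k + d u + ∫ (1 - e^{-uy}) μ(dy)` for real `u ≥ 0`. -/
noncomputable def toFun (φ : BernsteinFunction) (u : ℝ) : ℝ :=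
  φ.killing + φ.drift * u + ∫ y in Ioi 0, (1 - Real.exp (-(u * y))) ∂φ.levy

/-- The extension `φ(z) = k + d z + ∫ (1 - e^{-zy}) μ(dy)` to complex `z`, `Re z ≥ 0`. -/
noncomputable def ext (φ : BernsteinFunction) (z : ℂ) : ℂ :=
  φ.killing + φ.drift * z + ∫ y in Ioi (0 : ℝ), (1 - Complex.exp (-(z * y))) ∂φ.levy

/-- The logarithmic derivative `φ'(u) / φ(u)`. -/
noncomputable def logDer (φ : BernsteinFunction) (u : ℝ) : ℝ :=
  deriv φ.toFun u / φ.toFun u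

/-- `φ^t(z) = e^{t Log φ(z)}`, with the principal logarithm. -/
noncomputable def extPow (φ : BernsteinFunction) (t : ℝ) (z : ℂ) : ℂ :=
  Complex.exp (t * Complex.log (φ.ext z))

/-- `∑_{k=1}^n φ'(k)/φ(k) - log φ(n)`, the sequence whose limit is `γ_φ`. -/
noncomputable def gammaSeq (φ : BernsteinFunction) (n : ℕ) : ℝ :=
  ∑ k ∈ Finset.Icc 1 n, φ.logDer k - Real.log (φ.toFun n)

/-- `γ_φ`, the generalized Euler-Mascheroni constant. -/
noncomputable def gammaConst (φ : BernsteinFunction) : ℝ :=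
  limUnder atTop φ.gammaSeq

/-- `φ(k) / φ(k + z) · e^{(φ'(k)/φ(k)) z}`, the `k`-th factor of the Weierstrass product. -/
noncomputable def factor (φ : BernsteinFunction) (k : ℕ) (z : ℂ) : ℂ :=
  φ.ext k / φ.ext (k + z) * Complex.exp (φ.logDer k * z)

/-- The Bernstein-Gamma function
`W_φ(z) = e^{-γ_φ z} / φ(z) · ∏_{k ≥ 1} φ(k) / φ(k + z) · e^{(φ'(k)/φ(k)) z}`. -/
noncomputable def W (φ : BernsteinFunction) (z : ℂ) : ℂ :=
  Complex.exp (-(φ.gammaConst * z)) / φ.ext z * ∏' k : ℕ, φ.factor (k + 1) z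

/-- `κ` is the measure on `(0, ∞)` with `∫ e^{-uy} κ(dy) = φ'(u)/φ(u)` for all `u > 0`. -/
def IsKappa (φ : BernsteinFunction) (κ : Measure ℝ) : Prop :=
  κ (Iic 0) = 0 ∧
    ∀ u : ℝ, 0 < u → ∫⁻ y, ENNReal.ofReal (Real.exp (-(u * y))) ∂κ = ENNReal.ofReal (φ.logDer u)

/-- `Ψ(z) = z log φ(1) + ∫ (e^{-zy} - 1 - z (e^{-y} - 1)) κ(dy) / (y (e^y - 1))`. -/
noncomputable def Psi (φ : BernsteinFunction) (κ : Measure ℝ) (z : ℂ) : ℂ :=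
  z * Real.log (φ.toFun 1) +
    ∫ y in Ioi (0 : ℝ), (Complex.exp (-(z * y)) - 1 - z * (Complex.exp (-(y : ℂ)) - 1)) /
      (y * (Complex.exp y - 1)) ∂κ

end BernsteinFunction

/-- The moment transform `M_ρ(z) = ∫_{[0,∞)} x^z ρ(dx)`. -/
noncomputable def momentTransform (ρ : Measure ℝ) (z : ℂ) : ℂ :=
  ∫ x in Ici (0 : ℝ), (x : ℂ) ^ z ∂ρ

/-- `(ν_t)_{t ≥ 0}` is the Berg-Urbanik semigroup associated to `φ`: a multiplicative convolution
semigroup of probability measures on `[0, ∞)` with `M_{ν_t}(z) = e^{t Ψ(z)}` for `Re z > 0`. -/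
structure IsBergUrbanik (φ : BernsteinFunction) (ν : ℝ≥0 → Measure ℝ) : Prop where
  prob : ∀ t, IsProbabilityMeasure (ν t)
  support : ∀ t, ν t (Iio 0) = 0
  semigroup : ∀ s t, (ν s).mconv (ν t) = ν (s + t)
  transform : ∃ κ : Measure ℝ, φ.IsKappa κ ∧
    ∀ (t : ℝ≥0) (z : ℂ), 0 < z.re →
      momentTransform (ν t) z = Complex.exp ((t : ℝ) * φ.Psi κ z)

/-- The open right half-plane `Re z > 0`. -/
def rightHalfPlane : Set ℂ := {z | 0 < z.re}

/-- `L` is an analytic logarithm of `f` on the right half-plane, normalized by `L 1 = 0`.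
For given `f` there is at most one, as a function on the right half-plane. -/
def IsLogBranch (f L : ℂ → ℂ) : Prop :=
  AnalyticOnNhd ℂ L rightHalfPlane ∧ L 1 = 0 ∧
    ∀ z ∈ rightHalfPlane, Complex.exp (L z) = f z

open Classical in
/-- The analytic logarithm of `f` on the right half-plane that vanishes at `1`
(and `0` if there is none). -/
noncomputable def logBranch (f : ℂ → ℂ) : ℂ → ℂ :=
  if h : ∃ L, IsLogBranch f L then h.choose else 0

/-- `W_φ^t(z) = e^{t log W_φ(z)}`, with the analytic logarithm of `W_φ` that vanishes at `1`. -/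
noncomputable def BernsteinFunction.WPow (φ : BernsteinFunction) (t : ℝ) (z : ℂ) : ℂ :=
  Complex.exp (t * logBranch φ.W z)

/-- Positive definiteness of the restriction of `f` to the imaginary axis: for all
`s₁, …, sₙ ∈ iℝ` and `c₁, …, cₙ ∈ ℂ`, the sum `∑ f(sᵢ - sⱼ) cᵢ conj(cⱼ)` is real and `≥ 0`. -/
def IsPosDefOnImag (f : ℂ → ℂ) : Prop :=
  ∀ (n : ℕ) (s c : Fin n → ℂ), (∀ i, (s i).re = 0) →
    (∑ i, ∑ j, f (s i - s j) * c i * (starRingEnd ℂ) (c j)).im = 0 ∧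
    0 ≤ (∑ i, ∑ j, f (s i - s j) * c i * (starRingEnd ℂ) (c j)).re

open scoped ComplexOrder ComplexConjugate

/-! Uniqueness uses no representing measure. If `f` is positive-definite on iℝ and analytic near it,
second differences in the direction i show that `f''` is positive-definite too. Hence the even
Taylor coefficients at 0 are nonnegative and f(x) + f(-x) ≥ 2 f(0). Twisting by an exponential gives
f(x) e^t + f(-x) e^{-t} ≥ 2 f(0), so f(x) ≥ 0. Applied to averages of translates of G, this carries
positive definiteness from 1 + iℝ to every line a + iℝ (`IsPosDefOnImag.of_one`) and makes G(x)
e^{tx} convex on (0, ∞) for every t, so log G is convex there. Since log φ(n+1) - log φ(n) → 0, the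
Bohr–Mollerup argument and the identity theorem determine G.

For the product, |(Log φ)'(z)| ≤ 1 / Re z, and a Cauchy estimate bounds (Log φ)'' by 4 / (Re z)².
The logarithms of the Weierstrass factors are therefore O(k⁻²), and their sum gives an analytic
logarithm `logW` of `W`. Its Gauss form yields the functional equation. It also yields positive
definiteness: 1/φ(a + ·) is a limit of geometric series in Laplace transforms of finite measures,
and `W` is a limit of products of such functions. Working with multipliers of positive-definite
functions makes closure under products immediate.

For the moments, expanding 1/(e^y - 1) geometrically and integrating the Laplace transform of κ
gives Ψ(x) = log W(x+1) for real x ≥ 1. By the identity theorem e^{tΨ(z)} agrees with exp(t log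
W(z+1)), which is analytic on Re z > -1. Landau's theorem turns this continuation into convergence
of the integral. -/

theorem isPosDefOnImag_iff {f : ℂ → ℂ} :
    IsPosDefOnImag f ↔ ∀ (n : ℕ) (s c : Fin n → ℂ), (∀ i, (s i).re = 0) →
      0 ≤ ∑ i, ∑ j, f (s i - s j) * c i * conj (c j) := by
  refine forall_congr' fun n => forall_congr' fun s => forall_congr' fun c => forall_congr' fun _ => ?_
  rw [Complex.nonneg_iff]
  exact ⟨fun h => ⟨h.2, h.1.symm⟩, fun h => ⟨h.2.symm, h.1⟩⟩

/-! ### Closure properties of positive definiteness -/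

namespace IsPosDefOnImag

variable {f g : ℂ → ℂ}

theorem sum_nonneg (hf : IsPosDefOnImag f) {ι : Type*} [Fintype ι] (s c : ι → ℂ)
    (hs : ∀ i, (s i).re = 0) : 0 ≤ ∑ i, ∑ j, f (s i - s j) * c i * conj (c j) := by
  have e := Fintype.equivFin ι
  have h := isPosDefOnImag_iff.1 hf _ (s ∘ e.symm) (c ∘ e.symm) (fun i => hs _)
  rw [← Equiv.sum_comp e.symm fun i => ∑ j, f (s i - s j) * c i * conj (c j)]
  convert h using 2 with i
  exact (Equiv.sum_comp e.symm fun j => f (s (e.symm i) - s j) * c (e.symm i) * conj (c j)).symm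

theorem congr (hf : IsPosDefOnImag f) (h : ∀ s : ℂ, s.re = 0 → g s = f s) : IsPosDefOnImag g := by
  rw [isPosDefOnImag_iff] at hf ⊢
  intro n s c hs
  convert hf n s c hs using 6 with i _ j
  exact h _ (by simp [hs])

theorem zero_nonneg (hf : IsPosDefOnImag f) : 0 ≤ f 0 := by
  simpa using hf.sum_nonneg (ι := Unit) (fun _ => 0) (fun _ => 1) (by simp)

/-- Test `f` at the points t_i + s_j with weights d_i c_j. Averages reduce positive definiteness of
a translation-invariant transform of `f` to nonnegativity of a single value. -/
theorem average (hf : IsPosDefOnImag f) {ι : Type*} [Fintype ι] (s c : ι → ℂ)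
    (hs : ∀ i, (s i).re = 0) :
    IsPosDefOnImag (fun z => ∑ i, ∑ j, f (z + (s i - s j)) * c i * conj (c j)) := by
  rw [isPosDefOnImag_iff]
  intro n t d ht
  have h := hf.sum_nonneg (ι := Fin n × ι) (fun p => t p.1 + s p.2) (fun p => d p.1 * c p.2)
    (by simp [ht, hs])
  convert h using 1
  rw [Fintype.sum_prod_type]
  refine Finset.sum_congr rfl fun i _ => ?_
  simp_rw [Fintype.sum_prod_type, Finset.sum_mul]
  rw [Finset.sum_comm]
  refine Finset.sum_congr rfl fun j _ => Finset.sum_congr rfl fun k _ => Finset.sum_congr rfl fun l _ => ?_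
  rw [show t i - t k + (s j - s l) = t i + s j - (t k + s l) by ring, map_mul]
  ring

theorem of_tendsto {ι : Type*} {l : Filter ι} [l.NeBot] {F : ι → ℂ → ℂ}
    (hF : ∀ᶠ i in l, IsPosDefOnImag (F i))
    (h : ∀ s : ℂ, s.re = 0 → Tendsto (fun i => F i s) l (𝓝 (f s))) : IsPosDefOnImag f := by
  rw [isPosDefOnImag_iff]
  intro n s c hs
  refine ge_of_tendsto (x := l)
    (tendsto_finsetSum _ fun i _ => tendsto_finsetSum _ fun j _ =>
      ((h (s i - s j) (by simp [hs])).mul_const (c i)).mul_const (conj (c j))) ?_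
  filter_upwards [hF] with i hi using isPosDefOnImag_iff.1 hi n s c hs

theorem add (hf : IsPosDefOnImag f) (hg : IsPosDefOnImag g) : IsPosDefOnImag (fun s => f s + g s) := by
  rw [isPosDefOnImag_iff] at *
  intro n s c hs
  convert add_nonneg (hf n s c hs) (hg n s c hs) using 1
  simp_rw [← Finset.sum_add_distrib, add_mul]

theorem const_mul (hf : IsPosDefOnImag f) {a : ℂ} (ha : 0 ≤ a) : IsPosDefOnImag (fun s => a * f s) := by
  rw [isPosDefOnImag_iff] at *
  intro n s c hs
  convert mul_nonneg ha (hf n s c hs) using 1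
  simp_rw [Finset.mul_sum, mul_assoc]

theorem one : IsPosDefOnImag (fun _ => 1) := by
  rw [isPosDefOnImag_iff]
  intro n s c _
  have : ∑ i, ∑ j, 1 * c i * conj (c j) = (∑ i, c i) * conj (∑ i, c i) := by
    rw [map_sum, Finset.sum_mul_sum]; simp
  rw [this]
  exact mul_star_self_nonneg _

theorem exp_mul (hf : IsPosDefOnImag f) (y : ℝ) : IsPosDefOnImag (fun s => f s * Complex.exp (y * s)) := by
  rw [isPosDefOnImag_iff] at *
  intro n s c hs
  have h := hf n s (fun i => c i * Complex.exp (y * s i)) hs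
  refine h.trans_eq (Finset.sum_congr rfl fun i _ => Finset.sum_congr rfl fun j _ => ?_)
  have : conj (s j) = - s j := by
    apply Complex.ext <;> simp [hs]
  rw [map_mul, ← Complex.exp_conj, map_mul, this, Complex.conj_ofReal, mul_sub, Complex.exp_sub,
    mul_neg, Complex.exp_neg]
  ring

theorem secondDifference_nonneg (hf : IsPosDefOnImag f) (h : ℝ) :
    0 ≤ 2 * f 0 - f (Complex.I * h) - f (-(Complex.I * h)) := by
  have := hf.sum_nonneg (ι := Fin 2) ![0, Complex.I * h] ![1, -1] (by intro i; fin_cases i <;> simp)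
  simp [Fin.sum_univ_two] at this
  convert this using 1
  ring

end IsPosDefOnImag

/-! ### Derivatives, and values off the imaginary axis -/

/-- The second symmetric difference quotient along the imaginary axis tends to `f''`. -/
theorem AnalyticAt.tendsto_secondDifference {f : ℂ → ℂ} {z : ℂ} (hf : AnalyticAt ℂ f z) :
    Tendsto (fun h : ℝ => (2 * f z - f (z + Complex.I * h) - f (z + -(Complex.I * h))) / (h : ℂ) ^ 2)
      (𝓝[≠] 0) (𝓝 (iteratedDeriv 2 f z)) := by
  have hO := hf.hasFPowerSeriesAt.isBigO_sub_partialSum_pow 3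
  set P := (FormalMultilinearSeries.ofScalars ℂ fun n => iteratedDeriv n f z / n.factorial) with hP
  set r : ℂ → ℂ := fun y => f (z + y) - P.partialSum 3 y with hr
  have hr3 : r =O[𝓝 0] fun y => y ^ 3 := hO.trans (by
    simpa only [← norm_pow] using (Asymptotics.isBigO_refl (fun y : ℂ => y ^ 3) (𝓝 0)).norm_left)
  have hlim (w : ℂ) : Tendsto (fun h : ℝ => r (w * h) / (h : ℂ) ^ 2) (𝓝[≠] 0) (𝓝 0) := by
    have h1 : Tendsto (fun h : ℝ => w * (h : ℂ)) (𝓝[≠] 0) (𝓝 0) := by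
      have : Continuous fun h : ℝ => w * (h : ℂ) := by fun_prop
      simpa using (this.tendsto 0).mono_left nhdsWithin_le_nhds
    have h2 : (fun h : ℝ => r (w * h)) =O[𝓝[≠] 0] fun h : ℝ => (h : ℂ) ^ 3 := by
      refine (hr3.comp_tendsto h1).trans ?_
      simp only [Function.comp_def, mul_pow]
      exact Asymptotics.isBigO_const_mul_self _ _ _
    have h3 : (fun h : ℝ => r (w * h) / (h : ℂ) ^ 2) =O[𝓝[≠] 0] fun h : ℝ => (h : ℂ) := by
      refine (h2.mul (Asymptotics.isBigO_refl (fun h : ℝ => ((h : ℂ) ^ 2)⁻¹) _)).congr'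
        (Eventually.of_forall fun h => (div_eq_mul_inv _ _).symm) ?_
      filter_upwards [self_mem_nhdsWithin] with h hh
      have : (h : ℂ) ≠ 0 := by exact_mod_cast hh
      field_simp
    refine h3.trans_tendsto ?_
    simpa using (Complex.continuous_ofReal.tendsto 0).mono_left nhdsWithin_le_nhds
  -- The first-order terms at ±ih cancel, and I² = -1 turns the negated second difference into +f''.
  have hmain := ((hlim Complex.I).add (hlim (-Complex.I))).const_sub (iteratedDeriv 2 f z)
  rw [add_zero, sub_zero] at hmain
  refine hmain.congr' ?_
  filter_upwards [self_mem_nhdsWithin] with h hh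
  have hh : (h : ℂ) ≠ 0 := by exact_mod_cast hh
  simp only [hr, hP, FormalMultilinearSeries.partialSum, Finset.sum_range_succ,
    Finset.range_zero, Finset.sum_empty, FormalMultilinearSeries.ofScalars_apply_eq]
  simp
  field_simp
  simp only [Complex.I_sq]
  ring

theorem IsPosDefOnImag.iteratedDeriv_two_nonneg {f : ℂ → ℂ} (hf : IsPosDefOnImag f)
    (ha : AnalyticAt ℂ f 0) : 0 ≤ iteratedDeriv 2 f 0 := by
  refine ge_of_tendsto ha.tendsto_secondDifference (Eventually.of_forall fun h => ?_)
  have := hf.secondDifference_nonneg h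
  rw [zero_add, zero_add, div_eq_mul_inv]
  refine mul_nonneg this ?_
  rw [← Complex.ofReal_pow, ← Complex.ofReal_inv]
  exact Complex.zero_le_real.2 (by positivity)

theorem IsPosDefOnImag.iteratedDeriv_two {f : ℂ → ℂ} (hf : IsPosDefOnImag f)
    (ha : ∀ s : ℂ, s.re = 0 → AnalyticAt ℂ f s) : IsPosDefOnImag (iteratedDeriv 2 f) := by
  rw [isPosDefOnImag_iff]
  intro n s c hs
  have hA (i j : Fin n) : AnalyticAt ℂ f (s i - s j) := ha _ (by simp [hs])
  have hA' (i j : Fin n) : AnalyticAt ℂ (fun z => f (z + (s i - s j))) 0 :=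
    AnalyticAt.fun_comp_of_eq (hA i j) (by fun_prop) (zero_add _)
  have h := (hf.average s c hs).iteratedDeriv_two_nonneg
    (Finset.analyticAt_fun_sum _ fun i _ => Finset.analyticAt_fun_sum _ fun j _ =>
      ((hA' i j).mul analyticAt_const).mul analyticAt_const)
  refine h.trans_eq ?_
  rw [iteratedDeriv_fun_sum fun i _ => ContDiffAt.sum fun j _ =>
    (((hA' i j).contDiffAt.mul contDiffAt_const).mul contDiffAt_const)]
  refine Finset.sum_congr rfl fun i _ => ?_
  rw [iteratedDeriv_fun_sum fun j _ =>
    (((hA' i j).contDiffAt.mul contDiffAt_const).mul contDiffAt_const)]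
  refine Finset.sum_congr rfl fun j _ => ?_
  rw [iteratedDeriv_mul_const_field, iteratedDeriv_mul_const_field, iteratedDeriv_comp_add_const]
  simp

theorem IsPosDefOnImag.iteratedDeriv_even {f : ℂ → ℂ} (hf : IsPosDefOnImag f)
    (ha : ∀ s : ℂ, s.re = 0 → AnalyticAt ℂ f s) (n : ℕ) :
    IsPosDefOnImag (iteratedDeriv (2 * n) f) := by
  induction n with
  | zero => simpa
  | succ n ih =>
    have := ih.iteratedDeriv_two fun s hs => by
      rw [iteratedDeriv_eq_iterate]; exact (ha s hs).iterated_deriv _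
    simp only [iteratedDeriv_eq_iterate] at this ⊢
    rwa [← Function.iterate_add_apply, add_comm 2] at this

/-- The even part of the Taylor series of `f` at `c`. -/
theorem hasSum_taylorSeries_even {f : ℂ → ℂ} {c w : ℂ} {r : ℝ}
    (hf : DifferentiableOn ℂ f (Metric.ball c r)) (hw : ‖w‖ < r) :
    HasSum (fun n : ℕ => 2 * (((2 * n).factorial : ℂ)⁻¹ * (w ^ (2 * n) * iteratedDeriv (2 * n) f c)))
      (f (c + w) + f (c - w)) := by
  have h1 := Complex.hasSum_taylorSeries_on_ball hf (z := c + w) (by simpa)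
  have h2 := Complex.hasSum_taylorSeries_on_ball hf (z := c - w) (by simpa [dist_eq_norm])
  have h := h1.add h2
  simp only [add_sub_cancel_left, sub_sub_cancel_left, smul_eq_mul] at h
  have hinj : Function.Injective fun n : ℕ => 2 * n := fun a b h => by simpa using h
  rw [← hinj.hasSum_iff] at h
  · refine h.congr_fun fun n => ?_
    simp only [Function.comp_apply, (even_two_mul n).neg_pow]
    ring
  · intro n hn
    have : Odd n := by
      rw [← Nat.not_even_iff_odd]
      rintro ⟨k, rfl⟩
      exact hn ⟨k, (two_mul k)⟩
    rw [this.neg_pow]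
    ring

/-- Every term of the even Taylor series is nonnegative; keep only the one with n = 0. -/
theorem IsPosDefOnImag.two_mul_le {f : ℂ → ℂ} (hf : IsPosDefOnImag f)
    (ha : ∀ s : ℂ, s.re = 0 → AnalyticAt ℂ f s) {r : ℝ}
    (hd : DifferentiableOn ℂ f (Metric.ball 0 r)) {x : ℝ} (hx : |x| < r) :
    2 * f 0 ≤ f x + f (-x) := by
  have h := hasSum_taylorSeries_even hd (w := x) (by simpa)
  rw [zero_add, zero_sub] at h
  have h0 (n : ℕ) : 0 ≤ 2 * (((2 * n).factorial : ℂ)⁻¹ * ((x : ℂ) ^ (2 * n) *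
      iteratedDeriv (2 * n) f 0)) := by
    have h1 : 0 ≤ ((2 * n).factorial : ℂ)⁻¹ := by
      rw [← Complex.ofReal_natCast, ← Complex.ofReal_inv]
      exact Complex.zero_le_real.2 (by positivity)
    have h2 : 0 ≤ (x : ℂ) ^ (2 * n) := by
      rw [← Complex.ofReal_pow, pow_mul]
      exact Complex.zero_le_real.2 (by positivity)
    exact mul_nonneg zero_le_two (mul_nonneg h1 (mul_nonneg h2 (hf.iteratedDeriv_even ha n).zero_nonneg))
  simpa using le_hasSum h 0 fun n _ => h0 n

/-- The twist by e^{(t/x)s} preserves positive definiteness, equals 1 at 0 and e^{±t} at ±x. -/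
theorem IsPosDefOnImag.two_mul_le_exp {f : ℂ → ℂ} (hf : IsPosDefOnImag f)
    (ha : ∀ s : ℂ, s.re = 0 → AnalyticAt ℂ f s) {r : ℝ}
    (hd : DifferentiableOn ℂ f (Metric.ball 0 r)) {x : ℝ} (hx : |x| < r) (hx0 : x ≠ 0) (t : ℝ) :
    2 * f 0 ≤ f x * Real.exp t + f (-x) * Real.exp (-t) := by
  have h := (hf.exp_mul (t / x)).two_mul_le (fun s hs => (ha s hs).mul (by fun_prop)) (r := r)
    (hd.mul (by fun_prop)) hx
  have h1 : ((t / x : ℝ) : ℂ) * x = t := by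
    rw [← Complex.ofReal_mul, div_mul_cancel₀ _ hx0]
  simpa [h1, mul_neg, -Complex.ofReal_div] using h

/-- Divide the twisted inequality by e^t and let t → ∞: the contribution of -x disappears. -/
theorem IsPosDefOnImag.nonneg_of_abs_lt {f : ℂ → ℂ} (hf : IsPosDefOnImag f)
    (ha : ∀ s : ℂ, s.re = 0 → AnalyticAt ℂ f s) {r : ℝ}
    (hd : DifferentiableOn ℂ f (Metric.ball 0 r)) {x : ℝ} (hx : |x| < r) :
    0 ≤ f x := by
  rcases eq_or_ne x 0 with rfl | hx0
  · simpa using hf.zero_nonneg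
  have key (t : ℝ) : 0 ≤ f x + f (-x) * (Real.exp (-t) * Real.exp (-t) : ℝ) := by
    have h := (mul_nonneg zero_le_two hf.zero_nonneg).trans (hf.two_mul_le_exp ha hd hx hx0 t)
    have h2 := mul_nonneg h (Complex.zero_le_real.2 (Real.exp_pos (-t)).le)
    have h3 : (Real.exp t : ℂ) * Real.exp (-t) = 1 := by
      rw [← Complex.ofReal_mul, ← Real.exp_add]; simp
    refine h2.trans_eq ?_
    rw [add_mul, mul_assoc, h3, mul_assoc, Complex.ofReal_mul, mul_one]
  have hl : Tendsto (fun t : ℝ => f x + f (-x) * (Real.exp (-t) * Real.exp (-t) : ℝ)) atTop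
      (𝓝 (f x + f (-x) * (0 * 0 : ℝ))) := by
    refine tendsto_const_nhds.add (tendsto_const_nhds.mul ?_)
    exact (Complex.continuous_ofReal.tendsto _).comp
      (Real.tendsto_exp_neg_atTop_nhds_zero.mul Real.tendsto_exp_neg_atTop_nhds_zero)
  simpa using ge_of_tendsto hl (Eventually.of_forall key)

/-! ### Positive-definite functions on the half-plane: log-convexity and positivity -/

theorem isOpen_rightHalfPlane : IsOpen rightHalfPlane :=
  isOpen_lt continuous_const Complex.continuous_re

theorem convex_rightHalfPlane : Convex ℝ rightHalfPlane := convex_halfSpace_re_gt 0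

theorem ball_subset_rightHalfPlane {z : ℂ} {r : ℝ} (hr : r ≤ z.re) :
    Metric.ball z r ⊆ rightHalfPlane := by
  intro w hw
  have h1 := (Complex.abs_re_le_norm (w - z)).trans_lt (by simpa [dist_eq_norm] using hw)
  have h2 := (abs_lt.1 h1).1
  simp only [Complex.sub_re] at h2
  show 0 < w.re
  linarith

theorem AnalyticOnNhd.shift_rightHalfPlane {G : ℂ → ℂ} (hG : AnalyticOnNhd ℂ G rightHalfPlane)
    (a : ℝ) {s : ℂ} (hs : -a < s.re) : AnalyticAt ℂ (fun s => G (a + s)) s :=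
  (hG (a + s) (show 0 < (a + s).re by simp; linarith)).fun_comp (by fun_prop)

theorem AnalyticOnNhd.differentiableOn_ball {G : ℂ → ℂ} (hG : AnalyticOnNhd ℂ G rightHalfPlane)
    (a : ℝ) : DifferentiableOn ℂ (fun s => G (a + s)) (Metric.ball 0 a) := by
  intro s hs
  refine (hG.shift_rightHalfPlane a ?_).differentiableAt.differentiableWithinAt
  have := (Complex.abs_re_le_norm s).trans_lt (by simpa using hs)
  exact (abs_lt.1 this).1

/-- Each quadratic form on the line b + iℝ is the value at b - a of an average of G(a + ·), and the
disc of radius a about a lies in the half-plane. -/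
theorem IsPosDefOnImag.shift {G : ℂ → ℂ} (hG : AnalyticOnNhd ℂ G rightHalfPlane) {a b : ℝ}
    (h : IsPosDefOnImag fun s => G (a + s)) (ha : 0 < a) (hab : |b - a| < a) :
    IsPosDefOnImag fun s => G (b + s) := by
  rw [isPosDefOnImag_iff]
  intro n s c hs
  have hA (i j : Fin n) {z : ℂ} (hz : -a < z.re) :
      AnalyticAt ℂ (fun z => G (a + (z + (s i - s j)))) z :=
    AnalyticAt.fun_comp_of_eq (f := fun z => z + (s i - s j))
      (hG.shift_rightHalfPlane a (s := z + (s i - s j)) (by simpa [hs])) (by fun_prop) rfl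
  have hS {z : ℂ} (hz : -a < z.re) := Finset.analyticAt_fun_sum Finset.univ fun i _ =>
    Finset.analyticAt_fun_sum Finset.univ fun j _ =>
      ((hA i j hz).mul (analyticAt_const (v := c i))).mul (analyticAt_const (v := conj (c j)))
  have := (h.average s c hs).nonneg_of_abs_lt (r := a) (fun z hz => hS (by simpa [hz]))
    (fun z hz => (hS ?_).differentiableAt.differentiableWithinAt) hab
  · convert this using 6 with i _ j
    push_cast; ring_nf
  · have := (Complex.abs_re_le_norm z).trans_lt (by simpa using hz)
    exact (abs_lt.1 this).1

theorem IsPosDefOnImag.of_one {G : ℂ → ℂ} (hG : AnalyticOnNhd ℂ G rightHalfPlane)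
    (h : IsPosDefOnImag fun s => G (1 + s)) {a : ℝ} (ha : 0 < a) :
    IsPosDefOnImag fun s => G (a + s) := by
  have key (n : ℕ) : ∀ a : ℝ, 0 < a → a < 2 ^ n → IsPosDefOnImag fun s => G (a + s) := by
    induction n with
    | zero =>
      intro a ha ha'
      have h' : IsPosDefOnImag fun s => G ((1 : ℝ) + s) := by simpa using h
      exact h'.shift hG one_pos (by rw [abs_lt]; constructor <;> linarith)
    | succ n ih =>
      intro a ha ha'
      -- One shift from c reaches every point of (0, 2c), so the reach doubles at each stage.
      obtain ⟨c, hc, hc'⟩ := exists_between (show a / 2 < 2 ^ n by rw [pow_succ] at ha'; linarith)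
      exact (ih c (by linarith) hc').shift hG (by linarith)
        (by rw [abs_lt]; constructor <;> linarith)
  obtain ⟨n, hn⟩ := pow_unbounded_of_one_lt a one_lt_two
  exact key n a ha hn

theorem IsPosDefOnImag.apply_nonneg {G : ℂ → ℂ} (hG : AnalyticOnNhd ℂ G rightHalfPlane)
    (h : IsPosDefOnImag fun s => G (1 + s)) {a : ℝ} (ha : 0 < a) : 0 ≤ G a := by
  simpa using (h.of_one hG ha).zero_nonneg

theorem IsPosDefOnImag.apply_eq_ofReal_re {G : ℂ → ℂ} (hG : AnalyticOnNhd ℂ G rightHalfPlane)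
    (h : IsPosDefOnImag fun s => G (1 + s)) {a : ℝ} (ha : 0 < a) : G a = ((G a).re : ℂ) :=
  Complex.eq_re_of_ofReal_le (r := 0) (by rw [Complex.ofReal_zero]; exact h.apply_nonneg hG ha)

theorem IsPosDefOnImag.convexOn_re {G : ℂ → ℂ} (hG : AnalyticOnNhd ℂ G rightHalfPlane)
    (h : IsPosDefOnImag fun s => G (1 + s)) : ConvexOn ℝ (Ioi 0) fun x : ℝ => (G x).re := by
  have hd {F : ℂ → ℂ} (hF : AnalyticOnNhd ℂ F rightHalfPlane) {x : ℝ} (hx : x ∈ Ioi (0 : ℝ)) :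
      HasDerivAt (fun x : ℝ => (F x).re) (deriv F x).re x :=
    (hF x (by simpa [rightHalfPlane] using hx)).differentiableAt.hasDerivAt.real_of_complex
  refine convexOn_of_hasDerivWithinAt2_nonneg (f' := fun x : ℝ => (deriv G x).re)
    (f'' := fun x : ℝ => (deriv (deriv G) x).re) (convex_Ioi 0)
    (fun x hx => (hd hG hx).continuousAt.continuousWithinAt) ?_ ?_ ?_
  · intro x hx
    exact (hd hG (interior_subset hx)).hasDerivWithinAt
  · intro x hx
    exact (hd hG.deriv (interior_subset hx)).hasDerivWithinAt
  · intro x hx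
    have hx : 0 < x := interior_subset hx
    have h2 := (h.of_one hG hx).iteratedDeriv_two_nonneg
      (hG.shift_rightHalfPlane x (by simpa using hx))
    rw [iteratedDeriv_comp_const_add, iteratedDeriv_succ, iteratedDeriv_one] at h2
    simpa using (Complex.nonneg_iff.1 h2).1

theorem IsPosDefOnImag.convexOn_exp_mul_re {G : ℂ → ℂ} (hG : AnalyticOnNhd ℂ G rightHalfPlane)
    (h : IsPosDefOnImag fun s => G (1 + s)) (t : ℝ) :
    ConvexOn ℝ (Ioi 0) fun x : ℝ => (G x).re * Real.exp (t * x) := by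
  have h1 : IsPosDefOnImag fun s => G (1 + s) * Complex.exp (t * (1 + s)) := by
    refine ((h.exp_mul t).const_mul (Complex.zero_le_real.2 (Real.exp_pos t).le)).congr fun s _ => ?_
    rw [mul_add, Complex.exp_add, Complex.ofReal_exp, mul_one]
    ring
  have := h1.convexOn_re (G := fun s => G s * Complex.exp (t * s)) (hG.mul (fun s _ => by fun_prop))
  convert this using 2 with x
  rw [← Complex.ofReal_mul, ← Complex.ofReal_exp, Complex.re_mul_ofReal]

theorem IsPosDefOnImag.convexOn_log {G : ℂ → ℂ} (hG : AnalyticOnNhd ℂ G rightHalfPlane)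
    (h : IsPosDefOnImag fun s => G (1 + s)) (hpos : ∀ x : ℝ, 0 < x → 0 < (G x).re) :
    ConvexOn ℝ (Ioi 0) fun x : ℝ => Real.log (G x).re := by
  refine ⟨convex_Ioi 0, fun x hx y hy a b ha hb hab => ?_⟩
  rcases eq_or_ne x y with rfl | hxy
  · simp [← add_mul, hab]
  have hz : a • x + b • y ∈ Ioi (0 : ℝ) := convex_Ioi 0 hx hy ha hb hab
  have gx := hpos x hx
  have gy := hpos y hy
  have gz := hpos _ hz
  -- With t chosen so that G(u) e^{tu} takes equal values at both endpoints, ordinary convexity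
  -- bounds the middle value by that common value. Taking logarithms gives log-convexity.
  obtain ⟨t, ht⟩ : ∃ t : ℝ, Real.log (G x).re + t * x = Real.log (G y).re + t * y :=
    ⟨(Real.log (G y).re - Real.log (G x).re) / (x - y), by
      have := sub_ne_zero.2 hxy; field_simp; ring⟩
  have hc := (h.convexOn_exp_mul_re hG t).2 hx hy ha hb hab
  have e (u : ℝ) (hu : 0 < (G u).re) :
      (G u).re * Real.exp (t * u) = Real.exp (Real.log (G u).re + t * u) := by
    rw [Real.exp_add, Real.exp_log hu]
  simp only [] at hc
  rw [e _ gx, e _ gy, e _ gz, ht, ← add_smul, hab, one_smul, Real.exp_le_exp] at hc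
  simp only [smul_eq_mul] at hc ⊢
  obtain rfl : b = 1 - a := by linarith
  linear_combination hc - a * ht

/-- A solution of `G(z+1) = φ(z) G(z)`, `G(1) = 1`, with `φ > 0` on `(0, ∞)`, whose restriction to
`1 + iℝ` is positive definite, is positive on `(0, ∞)`. -/
theorem IsPosDefOnImag.re_pos {G φ : ℂ → ℂ} (hG : AnalyticOnNhd ℂ G rightHalfPlane)
    (h : IsPosDefOnImag fun s => G (1 + s)) (hφ : ∀ x : ℝ, 0 < x → 0 < φ x)
    (hfe : ∀ z ∈ rightHalfPlane, G (z + 1) = φ z * G z) (h1 : G 1 = 1) {x : ℝ} (hx : 0 < x) :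
    0 < (G x).re := by
  have hn (n : ℕ) : 0 < G ((n + 1 : ℝ) : ℂ) := by
    induction n with
    | zero => simp [h1]
    | succ n ih =>
      have h0 : (0 : ℝ) < n + 1 := by positivity
      have := hfe ((n + 1 : ℝ) : ℂ) (by simpa [rightHalfPlane] using h0)
      have h2 := mul_pos (hφ _ h0) ih
      rw [← this] at h2
      simpa using h2
  have hx0 := h.apply_nonneg hG hx
  have hx1 : 0 ≤ (G x).re := (Complex.nonneg_iff.1 hx0).1
  refine hx1.lt_of_ne fun h0 => ?_
  have hGx : G x = 0 := by rw [h.apply_eq_ofReal_re hG hx, ← h0]; simp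
  obtain ⟨n, hxn⟩ := exists_nat_gt x
  have hxn : x < (n : ℝ) + 1 := by linarith
  set a : ℝ := (n : ℝ) + 1 with ha
  have ha0 : 0 < a := hx.trans hxn
  -- Centre the twisted inequality at a, where G > 0. The term at x drops out because G(x) = 0,
  -- leaving only the reflected point 2a - x, whose weight tends to 0.
  have key (t : ℝ) : 2 * (G a).re ≤ (G (a + (a - x) : ℝ)).re * Real.exp (-t) := by
    have := (h.of_one hG ha0).two_mul_le_exp (x := a - x) (r := a)
      (fun s hs => hG.shift_rightHalfPlane a (by simpa [hs] using ha0))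
      (hG.differentiableOn_ball a) (by rw [abs_lt]; constructor <;> linarith) (by linarith) (-t)
    have h3 : (a : ℂ) + -((a - x : ℝ) : ℂ) = x := by push_cast; ring
    rw [h3, hGx, zero_mul, add_zero, add_zero, ← Complex.ofReal_add] at this
    have := (Complex.le_def.1 this).1
    rwa [← Complex.ofReal_ofNat, Complex.re_ofReal_mul, Complex.re_mul_ofReal] at this
  have hlim : Tendsto (fun t : ℝ => (G (a + (a - x) : ℝ)).re * Real.exp (-t)) atTop (𝓝 0) := by
    simpa using Real.tendsto_exp_neg_atTop_nhds_zero.const_mul _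
  have h4 := ge_of_tendsto hlim (Eventually.of_forall key)
  have h5 := (Complex.pos_iff.1 (hn n)).1
  rw [← ha] at h5
  linarith

/-! ### Bohr–Mollerup uniqueness -/

/-- A Bohr–Mollerup estimate. -/
theorem bohrMollerup_bounds {f g : ℝ → ℝ} (hf : ConvexOn ℝ (Ioi 0) f)
    (hfe : ∀ x, 0 < x → f (x + 1) = f x + g x) {x y : ℝ} (hx : 1 < x) (hy : 0 < y) (hy1 : y < 1) :
    y * g (x - 1) ≤ f (x + y) - f x ∧ f (x + y) - f x ≤ y * g x := by
  have h1 := hfe x (by linarith)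
  have h2 := hfe (x - 1) (by linarith)
  rw [sub_add_cancel] at h2
  constructor
  · have := hf.slope_mono_adjacent (x := x - 1) (y := x) (z := x + y)
      (by simp; linarith) (by simp; linarith) (by linarith) (by linarith)
    rw [add_sub_cancel_left, le_div_iff₀ hy, h2] at this
    simp at this
    linarith
  · have := hf.2 (show x ∈ Ioi 0 by simp; linarith) (show x + 1 ∈ Ioi 0 by simp; linarith)
      (show 0 ≤ 1 - y by linarith) hy.le (by ring)
    rw [h1] at this
    simp only [smul_eq_mul] at this
    rw [show (1 - y) * x + y * (x + 1) = x + y by ring] at this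
    linarith

/-- The difference of two solutions is unchanged by integer translations, while the estimates at n +
2 confine both increments to one interval of length y (g(n+2) - g(n+1)) → 0. -/
theorem bohrMollerup_unique {f₁ f₂ g : ℝ → ℝ} (hf₁ : ConvexOn ℝ (Ioi 0) f₁)
    (hf₂ : ConvexOn ℝ (Ioi 0) f₂)
    (hfe₁ : ∀ x, 0 < x → f₁ (x + 1) = f₁ x + g x) (hfe₂ : ∀ x, 0 < x → f₂ (x + 1) = f₂ x + g x)
    (h1 : f₁ 1 = f₂ 1) (hg : Tendsto (fun n : ℕ => g (n + 1) - g n) atTop (𝓝 0))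
    {y : ℝ} (hy : 0 < y) (hy1 : y < 1) : f₁ y = f₂ y := by
  have hper (n : ℕ) (u : ℝ) (hu : 0 < u) : f₁ (u + n) - f₂ (u + n) = f₁ u - f₂ u := by
    induction n with
    | zero => simp
    | succ n ih =>
      push_cast
      rw [← add_assoc, hfe₁ _ (by positivity), hfe₂ _ (by positivity), ← ih]
      ring
  have hb (n : ℕ) : |f₁ y - f₂ y| ≤ y * (g (n + 1 + 1) - g (n + 1)) := by
    have e1 := hper (n + 2) y hy
    have e2 := hper (n + 1) 1 one_pos
    rw [h1, sub_self] at e2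
    have b1 := bohrMollerup_bounds hf₁ hfe₁ (x := n + 2) (by linarith [n.cast_nonneg (α := ℝ)]) hy hy1
    have b2 := bohrMollerup_bounds hf₂ hfe₂ (x := n + 2) (by linarith [n.cast_nonneg (α := ℝ)]) hy hy1
    push_cast at e1 e2
    rw [show (n : ℝ) + 2 - 1 = n + 1 by ring] at b1 b2
    rw [show (1 : ℝ) + (n + 1) = n + 2 by ring] at e2
    rw [add_comm y] at e1
    rw [show (n : ℝ) + 1 + 1 = n + 2 by ring, abs_le]
    constructor <;> linarith [b1.1, b1.2, b2.1, b2.2]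
  have hl : Tendsto (fun n : ℕ => y * (g (n + 1 + 1) - g (n + 1))) atTop (𝓝 (y * 0)) := by
    simpa using (hg.comp (tendsto_add_atTop_nat 1)).const_mul y
  have := ge_of_tendsto hl (Eventually.of_forall hb)
  rw [mul_zero] at this
  exact sub_eq_zero.1 (abs_eq_zero.1 (this.antisymm (abs_nonneg _)))

/-- Two analytic functions on the right half-plane which agree on a real interval are equal. -/
theorem AnalyticOnNhd.eqOn_rightHalfPlane_of_Ioo {F G : ℂ → ℂ}
    (hF : AnalyticOnNhd ℂ F rightHalfPlane) (hG : AnalyticOnNhd ℂ G rightHalfPlane) {a b : ℝ}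
    (ha : 0 ≤ a) (hab : a < b) (h : ∀ x : ℝ, a < x → x < b → F x = G x) :
    EqOn F G rightHalfPlane := by
  obtain ⟨c, hc⟩ := exists_between hab
  refine hF.eqOn_of_preconnected_of_frequently_eq hG convex_rightHalfPlane.isPreconnected
    (z₀ := (c : ℂ)) (show 0 < (c : ℂ).re by simpa using ha.trans_lt hc.1) ?_
  have h1 : ∃ᶠ x : ℝ in 𝓝[≠] c, F x = G x := by
    refine Eventually.frequently ?_
    filter_upwards [mem_nhdsWithin_of_mem_nhds (Ioo_mem_nhds hc.1 hc.2)] with x hx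
      using h x hx.1 hx.2
  have h2 : Tendsto (fun x : ℝ => (x : ℂ)) (𝓝[≠] c) (𝓝[≠] (c : ℂ)) :=
    tendsto_nhdsWithin_of_tendsto_nhds_of_eventually_within _
      ((Complex.continuous_ofReal.tendsto c).mono_left nhdsWithin_le_nhds)
      (by filter_upwards [self_mem_nhdsWithin] with x hx; simpa using hx)
  exact h2.frequently h1

theorem IsPosDefOnImag.unique_solution {G₁ G₂ φ : ℂ → ℂ}
    (hG₁ : AnalyticOnNhd ℂ G₁ rightHalfPlane) (hG₂ : AnalyticOnNhd ℂ G₂ rightHalfPlane)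
    (h₁ : IsPosDefOnImag fun s => G₁ (1 + s)) (h₂ : IsPosDefOnImag fun s => G₂ (1 + s))
    (hφ : ∀ x : ℝ, 0 < x → 0 < φ x)
    (hlim : Tendsto (fun n : ℕ => Real.log (φ (n + 1 : ℝ)).re - Real.log (φ (n : ℝ)).re) atTop (𝓝 0))
    (hfe₁ : ∀ z ∈ rightHalfPlane, G₁ (z + 1) = φ z * G₁ z)
    (hfe₂ : ∀ z ∈ rightHalfPlane, G₂ (z + 1) = φ z * G₂ z) (h1 : G₁ 1 = 1) (h2 : G₂ 1 = 1) :
    EqOn G₁ G₂ rightHalfPlane := by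
  have hlog {G : ℂ → ℂ} (hG : AnalyticOnNhd ℂ G rightHalfPlane)
      (h : IsPosDefOnImag fun s => G (1 + s)) (h1 : G 1 = 1)
      (hfe : ∀ z ∈ rightHalfPlane, G (z + 1) = φ z * G z) (x : ℝ) (hx : 0 < x) :
      Real.log (G (x + 1 : ℝ)).re = Real.log (G x).re + Real.log (φ x).re := by
    have h3 := hfe x (by simpa [rightHalfPlane] using hx)
    have h4 := h.re_pos hG hφ hfe h1 hx
    have h5 := (Complex.pos_iff.1 (hφ x hx)).1
    rw [h.apply_eq_ofReal_re hG hx] at h3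
    push_cast
    rw [h3, Complex.re_mul_ofReal, Real.log_mul h5.ne' h4.ne', add_comm]
  refine hG₁.eqOn_rightHalfPlane_of_Ioo hG₂ le_rfl one_pos fun x hx hx1 => ?_
  have p₁ := fun x hx => h₁.re_pos (x := x) hG₁ hφ hfe₁ h1 hx
  have p₂ := fun x hx => h₂.re_pos (x := x) hG₂ hφ hfe₂ h2 hx
  have := bohrMollerup_unique (g := fun x : ℝ => Real.log (φ x).re) (h₁.convexOn_log hG₁ p₁)
    (h₂.convexOn_log hG₂ p₂) (hlog hG₁ h₁ h1 hfe₁) (hlog hG₂ h₂ h2 hfe₂) (by simp [h1, h2])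
    hlim hx hx1
  rw [h₁.apply_eq_ofReal_re hG₁ hx, h₂.apply_eq_ofReal_re hG₂ hx,
    Real.log_injOn_pos (p₁ x hx) (p₂ x hx) this]

/-! ### Bernstein functions on the half-plane and bounds for Log φ -/

theorem norm_one_sub_cexp_neg_le {w : ℂ} (hw : 0 ≤ w.re) : ‖1 - Complex.exp (-w)‖ ≤ ‖w‖ := by
  have hd (x : ℂ) (_ : x ∈ {x : ℂ | 0 ≤ x.re}) :
      HasDerivWithinAt (fun x => Complex.exp (-x)) (-Complex.exp (-x)) {x : ℂ | 0 ≤ x.re} x := by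
    simpa using ((hasDerivAt_id x).neg.cexp).hasDerivWithinAt
  have := (convex_halfSpace_re_ge 0).norm_image_sub_le_of_norm_hasDerivWithin_le (C := 1) hd
    (fun x hx => by simpa [Complex.norm_exp] using hx) (x := w) (y := 0) hw (by simp)
  simpa using this

namespace BernsteinFunction

variable (φ : BernsteinFunction)

theorem integrable_min : Integrable (fun y : ℝ => min 1 y) (φ.levy.restrict (Ioi 0)) := by
  refine ⟨by fun_prop, ?_⟩
  rw [hasFiniteIntegral_iff_ofReal]
  · exact (setLIntegral_le_lintegral _ _).trans_lt φ.levy_int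
  · filter_upwards [ae_restrict_mem measurableSet_Ioi] with y hy
    exact le_min zero_le_one (le_of_lt hy)

theorem norm_one_sub_cexp_le {z : ℂ} (hz : 0 ≤ z.re) {y : ℝ} (hy : 0 < y) :
    ‖1 - Complex.exp (-(z * y))‖ ≤ (2 + ‖z‖) * min 1 y := by
  have hre : 0 ≤ (z * y).re := by rw [Complex.re_mul_ofReal]; positivity
  rcases le_total 1 y with h | h
  · rw [min_eq_left h]
    refine (norm_sub_le _ _).trans ?_
    have : ‖Complex.exp (-(z * y))‖ ≤ 1 := by
      rw [Complex.norm_exp, Real.exp_le_one_iff]; simpa using hre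
    simp only [norm_one]
    linarith [norm_nonneg z]
  · rw [min_eq_right h]
    refine (norm_one_sub_cexp_neg_le hre).trans ?_
    rw [norm_mul, Complex.norm_real, Real.norm_of_nonneg hy.le]
    nlinarith

theorem integrable_one_sub_cexp {z : ℂ} (hz : 0 ≤ z.re) :
    Integrable (fun y : ℝ => 1 - Complex.exp (-(z * y))) (φ.levy.restrict (Ioi 0)) := by
  refine (φ.integrable_min.const_mul (2 + ‖z‖)).mono' (by fun_prop) ?_
  filter_upwards [ae_restrict_mem measurableSet_Ioi] with y hy
  exact norm_one_sub_cexp_le hz hy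

theorem integrable_one_sub_exp {u : ℝ} (hu : 0 ≤ u) :
    Integrable (fun y : ℝ => 1 - Real.exp (-(u * y))) (φ.levy.restrict (Ioi 0)) := by
  have := (φ.integrable_one_sub_cexp (z := u) (by simpa)).re
  refine this.congr (Eventually.of_forall fun y => ?_)
  simp [Complex.exp_re]

theorem mul_exp_neg_le {u y : ℝ} (hu : 0 < u) (hy : 0 < y) :
    y * Real.exp (-(u * y)) ≤ (1 + 1 / u) * min 1 y := by
  have h1 : 0 < 1 / u := by positivity
  rcases le_total 1 y with h | h
  · rw [min_eq_left h, Real.exp_neg]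
    have := Real.add_one_le_exp (u * y)
    have h2 : y * (Real.exp (u * y))⁻¹ ≤ 1 / u := by
      rw [← div_eq_mul_inv, div_le_div_iff₀ (Real.exp_pos _) hu]
      linarith
    linarith
  · rw [min_eq_right h]
    have : Real.exp (-(u * y)) ≤ 1 := by rw [Real.exp_le_one_iff]; nlinarith
    nlinarith

/-- The derivative `d + ∫ y e^{-zy} μ(dy)` of `φ`. -/
noncomputable def extDeriv (z : ℂ) : ℂ :=
  φ.drift + ∫ y in Ioi (0 : ℝ), y * Complex.exp (-(z * y)) ∂φ.levy

theorem integrable_mul_exp {u : ℝ} (hu : 0 < u) :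
    Integrable (fun y : ℝ => y * Real.exp (-(u * y))) (φ.levy.restrict (Ioi 0)) := by
  refine (φ.integrable_min.const_mul (1 + 1 / u)).mono' (by fun_prop) ?_
  filter_upwards [ae_restrict_mem measurableSet_Ioi] with y hy
  rw [Real.norm_of_nonneg (mul_nonneg (le_of_lt hy) (Real.exp_pos _).le)]
  exact mul_exp_neg_le hu hy

theorem hasDerivAt_ext {z : ℂ} (hz : 0 < z.re) : HasDerivAt φ.ext (φ.extDeriv z) z := by
  have hball {w : ℂ} (hw : w ∈ Metric.ball z (z.re / 2)) : z.re / 2 < w.re := by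
    have := (Complex.abs_re_le_norm (w - z)).trans_lt (by simpa [dist_eq_norm] using hw)
    have := (abs_lt.1 this).1
    simp only [Complex.sub_re] at this
    linarith
  have h := (hasDerivAt_integral_of_dominated_loc_of_deriv_le
    (μ := φ.levy.restrict (Ioi 0)) (F := fun z (y : ℝ) => 1 - Complex.exp (-(z * y)))
    (F' := fun z (y : ℝ) => y * Complex.exp (-(z * y)))
    (bound := fun y : ℝ => y * Real.exp (-(z.re / 2 * y)))
    (Metric.ball_mem_nhds z (half_pos hz)) (Eventually.of_forall fun w => by fun_prop)
    (φ.integrable_one_sub_cexp hz.le) (by fun_prop) ?_ (φ.integrable_mul_exp (half_pos hz)) ?_).2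
  · have h2 := (((hasDerivAt_id z).const_mul (φ.drift : ℂ)).const_add (φ.killing : ℂ)).add h
    rw [mul_one] at h2
    exact h2
  · filter_upwards [ae_restrict_mem measurableSet_Ioi] with y hy w hw
    rw [norm_mul, Complex.norm_real, Real.norm_of_nonneg (le_of_lt hy), Complex.norm_exp]
    refine mul_le_mul_of_nonneg_left (Real.exp_le_exp.2 ?_) (le_of_lt hy)
    simp only [Complex.neg_re, Complex.re_mul_ofReal]
    have := hball hw
    have hy : 0 < y := hy
    nlinarith
  · refine Eventually.of_forall fun y w _ => ?_
    have : HasDerivAt (fun w : ℂ => -(w * y)) (-(1 * (y : ℂ))) w :=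
      ((hasDerivAt_id w).mul_const _).neg
    convert this.cexp.const_sub 1 using 1
    ring

theorem ext_ofReal (u : ℝ) : φ.ext u = φ.toFun u := by
  simp only [ext, toFun, Complex.ofReal_add, Complex.ofReal_mul, ← integral_complex_ofReal]
  simp

theorem extDeriv_ofReal (u : ℝ) :
    φ.extDeriv u = ((φ.drift + ∫ y in Ioi (0 : ℝ), y * Real.exp (-(u * y)) ∂φ.levy : ℝ) : ℂ) := by
  simp only [extDeriv, Complex.ofReal_add, ← integral_complex_ofReal]
  simp

theorem hasDerivAt_toFun {u : ℝ} (hu : 0 < u) : HasDerivAt φ.toFun (φ.extDeriv u).re u := by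
  have := (φ.hasDerivAt_ext (z := u) (by simpa)).real_of_complex
  simpa [ext_ofReal] using this

/-- Since Re e^{-zy} ≤ e^{-y Re z}. Thus φ maps the open half-plane into itself, where the principal
logarithm is analytic. -/
theorem toFun_le_re_ext {z : ℂ} (hz : 0 ≤ z.re) : φ.toFun z.re ≤ (φ.ext z).re := by
  have h1 : (∫ y in Ioi (0 : ℝ), (1 - Complex.exp (-(z * y))) ∂φ.levy).re =
      ∫ y in Ioi (0 : ℝ), (1 - Complex.exp (-(z * y))).re ∂φ.levy :=
    (integral_re (φ.integrable_one_sub_cexp hz)).symm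
  simp only [ext, toFun, Complex.add_re, Complex.re_ofReal_mul, Complex.ofReal_re, h1]
  gcongr
  · exact φ.integrable_one_sub_exp hz
  · exact (φ.integrable_one_sub_cexp hz).re
  · exact measurableSet_Ioi.nullMeasurableSet
  · rename ℝ => y
    simp only [Complex.sub_re, Complex.one_re]
    have := Complex.re_le_norm (Complex.exp (-(z * y)))
    rw [Complex.norm_exp] at this
    simp only [Complex.neg_re, Complex.re_mul_ofReal] at this
    linarith

theorem integral_one_sub_exp_nonneg {u : ℝ} (hu : 0 ≤ u) :
    0 ≤ ∫ y in Ioi (0 : ℝ), (1 - Real.exp (-(u * y))) ∂φ.levy := by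
  refine setIntegral_nonneg measurableSet_Ioi fun y hy => ?_
  have : 0 ≤ u * y := mul_nonneg hu (le_of_lt hy)
  simpa using this

/-- A zero at some u > 0 would make all three nonnegative terms vanish; the integral then forces μ
to have no mass on (0, ∞), and φ ≡ 0. -/
theorem toFun_pos (hφ : ∃ u : ℝ, 0 ≤ u ∧ φ.toFun u ≠ 0) {u : ℝ} (hu : 0 < u) : 0 < φ.toFun u := by
  have h1 := φ.killing_nonneg
  have h2 := mul_nonneg φ.drift_nonneg hu.le
  have h3 := φ.integral_one_sub_exp_nonneg hu.le
  refine (add_nonneg (add_nonneg h1 h2) h3).lt_of_ne' fun h0 => ?_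
  have e3 : ∫ y in Ioi (0 : ℝ), (1 - Real.exp (-(u * y))) ∂φ.levy = 0 := by linarith
  have e1 : φ.killing = 0 := by linarith
  have e2 : φ.drift = 0 := (mul_eq_zero.1 (show φ.drift * u = 0 by linarith)).resolve_right hu.ne'
  rw [setIntegral_eq_zero_iff_of_nonneg_ae ?_ (φ.integrable_one_sub_exp hu.le)] at e3
  · obtain ⟨v, hv, hv'⟩ := hφ
    refine hv' ?_
    have : ∫ y in Ioi (0 : ℝ), (1 - Real.exp (-(v * y))) ∂φ.levy = 0 := by
      refine integral_eq_zero_of_ae ?_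
      filter_upwards [e3, ae_restrict_mem measurableSet_Ioi] with y hy hy'
      have : 1 - Real.exp (-(u * y)) = 0 := hy
      have : u * y = 0 := by
        rw [sub_eq_zero, eq_comm, Real.exp_eq_one_iff] at this; linarith
      exact absurd this (mul_pos hu hy').ne'
    simp [toFun, e1, e2, this]
  · filter_upwards [ae_restrict_mem measurableSet_Ioi] with y hy
    have : 0 ≤ u * y := mul_nonneg hu.le (le_of_lt hy)
    simpa using this

/-- Integrate v e^{-v} ≤ 1 - e^{-v}, a form of 1 + v ≤ e^v. This is the source of all later bounds
on Log φ. -/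
theorem norm_extDeriv_mul_le {z : ℂ} (hz : 0 < z.re) : ‖φ.extDeriv z‖ * z.re ≤ φ.toFun z.re := by
  have h1 : ‖φ.extDeriv z‖ ≤
      φ.drift + ∫ y in Ioi (0 : ℝ), y * Real.exp (-(z.re * y)) ∂φ.levy := by
    refine (norm_add_le _ _).trans (add_le_add ?_ ?_)
    · rw [Complex.norm_real, Real.norm_of_nonneg φ.drift_nonneg]
    · refine (norm_integral_le_integral_norm _).trans_eq
        (setIntegral_congr_fun measurableSet_Ioi fun y hy => ?_)
      simp [Complex.norm_exp, abs_of_pos (show 0 < y from hy)]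
  have h2 : (∫ y in Ioi (0 : ℝ), y * Real.exp (-(z.re * y)) ∂φ.levy) * z.re ≤
      ∫ y in Ioi (0 : ℝ), (1 - Real.exp (-(z.re * y))) ∂φ.levy := by
    rw [← integral_mul_const]
    refine setIntegral_mono_on ((φ.integrable_mul_exp hz).mul_const _)
      (φ.integrable_one_sub_exp hz.le) measurableSet_Ioi fun y _ => ?_
    have := Real.add_one_le_exp (z.re * y)
    have h3 : Real.exp (z.re * y) * Real.exp (-(z.re * y)) = 1 := by rw [← Real.exp_add]; simp
    have h4 := Real.exp_pos (-(z.re * y))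
    nlinarith
  have := mul_le_mul_of_nonneg_right h1 hz.le
  simp only [toFun]
  linarith [φ.killing_nonneg]

/-- `Log φ`, analytic on the right half-plane. -/
noncomputable def logExt (z : ℂ) : ℂ := Complex.log (φ.ext z)

section

variable (hφ : ∃ u : ℝ, 0 ≤ u ∧ φ.toFun u ≠ 0)
include hφ

theorem re_ext_pos {z : ℂ} (hz : 0 < z.re) : 0 < (φ.ext z).re :=
  (φ.toFun_pos hφ hz).trans_le (φ.toFun_le_re_ext hz.le)

theorem ext_ne_zero {z : ℂ} (hz : 0 < z.re) : φ.ext z ≠ 0 := by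
  intro h
  simpa [h] using φ.re_ext_pos hφ hz

theorem exp_logExt {z : ℂ} (hz : 0 < z.re) : Complex.exp (φ.logExt z) = φ.ext z :=
  Complex.exp_log (φ.ext_ne_zero hφ hz)

theorem logExt_ofReal {u : ℝ} (hu : 0 < u) : φ.logExt u = Real.log (φ.toFun u) := by
  rw [logExt, ext_ofReal, Complex.ofReal_log (φ.toFun_pos hφ hu).le]

theorem hasDerivAt_logExt {z : ℂ} (hz : 0 < z.re) :
    HasDerivAt φ.logExt (φ.extDeriv z / φ.ext z) z :=
  (φ.hasDerivAt_ext hz).clog (Or.inl (φ.re_ext_pos hφ hz))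

theorem analyticOnNhd_logExt : AnalyticOnNhd ℂ φ.logExt rightHalfPlane :=
  DifferentiableOn.analyticOnNhd
    (fun _ hz => (φ.hasDerivAt_logExt hφ hz).differentiableAt.differentiableWithinAt)
    isOpen_rightHalfPlane

theorem deriv_logExt_ofReal {u : ℝ} (hu : 0 < u) : deriv φ.logExt u = φ.logDer u := by
  rw [(φ.hasDerivAt_logExt hφ (z := u) (by simpa)).deriv, ext_ofReal, logDer,
    (φ.hasDerivAt_toFun hu).deriv, extDeriv_ofReal]
  simp

theorem norm_deriv_logExt_le {z : ℂ} (hz : 0 < z.re) : ‖deriv φ.logExt z‖ ≤ 1 / z.re := by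
  rw [(φ.hasDerivAt_logExt hφ hz).deriv, norm_div,
    div_le_div_iff₀ (norm_pos_iff.2 (φ.ext_ne_zero hφ hz)) hz, one_mul]
  exact (φ.norm_extDeriv_mul_le hz).trans ((φ.toFun_le_re_ext hz.le).trans (Complex.re_le_norm _))

/-- Cauchy's estimate on the circle of radius Re z / 2, where the first derivative is at most 2 / Re
z. -/
theorem norm_deriv_deriv_logExt_le {z : ℂ} (hz : 0 < z.re) :
    ‖deriv (deriv φ.logExt) z‖ ≤ 4 / z.re ^ 2 := by
  have hsub : Metric.closedBall z (z.re / 2) ⊆ rightHalfPlane :=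
    (Metric.closedBall_subset_ball (half_lt_self hz)).trans (ball_subset_rightHalfPlane le_rfl)
  have := Complex.norm_deriv_le_of_forall_mem_sphere_norm_le (c := z) (R := z.re / 2)
    (C := 2 / z.re) (f := deriv φ.logExt) (half_pos hz)
    (((φ.analyticOnNhd_logExt hφ).deriv.differentiableOn.mono hsub).diffContOnCl_ball subset_rfl)
    fun w hw => ?_
  · refine this.trans_eq ?_
    field_simp
    norm_num
  · have h1 : z.re / 2 ≤ w.re := by
      have := (Complex.abs_re_le_norm (w - z)).trans_eq (by simpa [dist_eq_norm] using hw)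
      have := (abs_le.1 this).1
      simp only [Complex.sub_re] at this
      linarith
    refine (φ.norm_deriv_logExt_le hφ ((half_pos hz).trans_le h1)).trans ?_
    rw [div_le_div_iff₀ ((half_pos hz).trans_le h1) hz]
    linarith

theorem norm_logExt_sub_le {u : ℝ} (hu : 0 < u) {w z : ℂ} (hw : u ≤ w.re) (hz : u ≤ z.re) :
    ‖φ.logExt z - φ.logExt w‖ ≤ 1 / u * ‖z - w‖ :=
  (convex_halfSpace_re_ge u).norm_image_sub_le_of_norm_deriv_le
    (fun _ hx => (φ.hasDerivAt_logExt hφ (hu.trans_le hx)).differentiableAt)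
    (fun _ hx => (φ.norm_deriv_logExt_le hφ (hu.trans_le hx)).trans
      (one_div_le_one_div_of_le hu hx)) hw hz

theorem norm_deriv_logExt_sub_le {u : ℝ} (hu : 0 < u) {w z : ℂ} (hw : u ≤ w.re) (hz : u ≤ z.re) :
    ‖deriv φ.logExt z - deriv φ.logExt w‖ ≤ 4 / u ^ 2 * ‖z - w‖ :=
  (convex_halfSpace_re_ge u).norm_image_sub_le_of_norm_deriv_le
    (fun x hx => ((φ.analyticOnNhd_logExt hφ).deriv x (hu.trans_le hx)).differentiableAt)
    (fun _ hx => (φ.norm_deriv_deriv_logExt_le hφ (hu.trans_le hx)).trans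
      (by gcongr; exact hx)) hw hz

/-- With w = k this makes the logarithm of the k-th Weierstrass factor O(k⁻²). -/
theorem norm_logExt_taylor_le {w z : ℂ} (hw : 0 < w.re) (hz : 0 ≤ z.re) :
    ‖φ.logExt w - φ.logExt (w + z) + deriv φ.logExt w * z‖ ≤ 4 / w.re ^ 2 * ‖z‖ ^ 2 := by
  have hconv : Convex ℝ ({x : ℂ | w.re ≤ x.re} ∩ Metric.closedBall w ‖z‖) :=
    (convex_halfSpace_re_ge _).inter (convex_closedBall _ _)
  have hd (x : ℂ) (hx : x ∈ {x : ℂ | w.re ≤ x.re} ∩ Metric.closedBall w ‖z‖) :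
      HasDerivAt (fun x => φ.logExt x - deriv φ.logExt w * x)
        (deriv φ.logExt x - deriv φ.logExt w) x := by
    have := (φ.hasDerivAt_logExt hφ (hw.trans_le hx.1)).differentiableAt.hasDerivAt.sub
      ((hasDerivAt_id x).const_mul (deriv φ.logExt w))
    rw [mul_one] at this
    exact this
  have := hconv.norm_image_sub_le_of_norm_hasDerivWithin_le
    (fun x hx => (hd x hx).hasDerivWithinAt) (C := 4 / w.re ^ 2 * ‖z‖)
    (fun x hx => (φ.norm_deriv_logExt_sub_le hφ hw le_rfl hx.1).trans
      (by gcongr; simpa [dist_eq_norm] using hx.2))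
    (x := w) (y := w + z) (by simp) (by simpa)
  rw [add_sub_cancel_left, ← norm_neg] at this
  convert this using 1
  · congr 1; ring
  · ring

end

end BernsteinFunction

/-! ### Analytic logarithms and the Weierstrass product -/

theorem IsLogBranch.eqOn {f L₁ L₂ : ℂ → ℂ} (h₁ : IsLogBranch f L₁) (h₂ : IsLogBranch f L₂) :
    EqOn L₁ L₂ rightHalfPlane := by
  have hd {z : ℂ} (hz : z ∈ rightHalfPlane) : deriv L₁ z = deriv L₂ z := by
    have e : (fun z => Complex.exp (L₁ z)) =ᶠ[𝓝 z] fun z => Complex.exp (L₂ z) := by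
      filter_upwards [isOpen_rightHalfPlane.mem_nhds hz] with w hw
      rw [h₁.2.2 w hw, h₂.2.2 w hw]
    have := e.deriv_eq
    rw [deriv_cexp (h₁.1 z hz).differentiableAt, deriv_cexp (h₂.1 z hz).differentiableAt,
      e.eq_of_nhds] at this
    exact mul_left_cancel₀ (Complex.exp_ne_zero _) this
  refine isOpen_rightHalfPlane.eqOn_of_deriv_eq convex_rightHalfPlane.isPreconnected
    h₁.1.differentiableOn h₂.1.differentiableOn (fun z hz => hd hz)
    (show (1 : ℂ) ∈ rightHalfPlane by simp [rightHalfPlane]) (by rw [h₁.2.1, h₂.2.1])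

theorem IsLogBranch.logBranch {f L : ℂ → ℂ} (h : IsLogBranch f L) :
    IsLogBranch f (logBranch f) := by
  have h' : ∃ L, IsLogBranch f L := ⟨L, h⟩
  rw [_root_.logBranch, dif_pos h']
  exact h'.choose_spec

namespace BernsteinFunction

variable (φ : BernsteinFunction)

/-- The logarithm of the `k`-th factor of the Weierstrass product. -/
noncomputable def logTerm (k : ℕ) (z : ℂ) : ℂ :=
  φ.logExt k - φ.logExt (k + z) + φ.logDer k * z

/-- The logarithm of `W_φ`. -/
noncomputable def logW (z : ℂ) : ℂ :=
  -(φ.gammaConst * z) - φ.logExt z + ∑' k : ℕ, φ.logTerm (k + 1) z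

variable (hφ : ∃ u : ℝ, 0 ≤ u ∧ φ.toFun u ≠ 0)
include hφ

theorem norm_logTerm_le (k : ℕ) {z : ℂ} (hz : 0 ≤ z.re) :
    ‖φ.logTerm (k + 1) z‖ ≤ 4 / ((k + 1 : ℕ) : ℝ) ^ 2 * ‖z‖ ^ 2 := by
  have h0 : (0 : ℝ) < (k + 1 : ℕ) := by positivity
  have := φ.norm_logExt_taylor_le hφ (w := ((k + 1 : ℕ) : ℝ)) (by simpa using h0) hz
  rw [φ.deriv_logExt_ofReal hφ h0] at this
  simpa [logTerm] using this

omit hφ in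
theorem summable_four_div_sq (C : ℝ) : Summable fun k : ℕ => 4 / ((k + 1 : ℕ) : ℝ) ^ 2 * C := by
  have := ((Real.summable_one_div_nat_pow (p := 2)).2 one_lt_two)
  have := (((summable_nat_add_iff 1).2 this).mul_left 4).mul_right C
  refine this.congr fun k => ?_
  rw [mul_one_div]

theorem summable_norm_logTerm {z : ℂ} (hz : 0 ≤ z.re) :
    Summable fun k : ℕ => ‖φ.logTerm (k + 1) z‖ :=
  (summable_four_div_sq (‖z‖ ^ 2)).of_nonneg_of_le (fun _ => norm_nonneg _)
    fun k => φ.norm_logTerm_le hφ k hz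

theorem analyticOnNhd_logTerm (k : ℕ) : AnalyticOnNhd ℂ (φ.logTerm (k + 1)) rightHalfPlane := by
  intro z hz
  have hz : 0 < z.re := hz
  have : AnalyticAt ℂ (fun z => φ.logExt (((k + 1 : ℕ) : ℂ) + z)) z :=
    (φ.analyticOnNhd_logExt hφ (((k + 1 : ℕ) : ℂ) + z)
      (show 0 < (((k + 1 : ℕ) : ℂ) + z).re by
        rw [Complex.add_re, Complex.natCast_re]; positivity)).fun_comp (by fun_prop)
  exact (analyticAt_const.sub this).add (by fun_prop)

theorem analyticOnNhd_tsum_logTerm :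
    AnalyticOnNhd ℂ (fun z => ∑' k : ℕ, φ.logTerm (k + 1) z) rightHalfPlane := by
  intro z hz
  have hU : IsOpen (rightHalfPlane ∩ Metric.ball 0 (‖z‖ + 1)) :=
    isOpen_rightHalfPlane.inter Metric.isOpen_ball
  refine ((Complex.differentiableOn_tsum_of_summable_norm
    (summable_four_div_sq ((‖z‖ + 1) ^ 2)) (fun k w hw =>
      (φ.analyticOnNhd_logTerm hφ k w hw.1).differentiableAt.differentiableWithinAt) hU
      fun k w hw => (φ.norm_logTerm_le hφ k (le_of_lt hw.1)).trans ?_).analyticOnNhd hU) z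
      ⟨hz, by simp⟩
  have : ‖w‖ ≤ ‖z‖ + 1 := (mem_ball_zero_iff.1 hw.2).le
  gcongr

theorem analyticOnNhd_logW : AnalyticOnNhd ℂ φ.logW rightHalfPlane := fun z hz =>
  ((show AnalyticAt ℂ (fun z : ℂ => -(φ.gammaConst * z)) z by fun_prop).sub
    (φ.analyticOnNhd_logExt hφ z hz)).add (φ.analyticOnNhd_tsum_logTerm hφ z hz)

theorem tendsto_logExt_natCast_add {w : ℂ} (hw : 0 ≤ w.re) :
    Tendsto (fun n : ℕ => φ.logExt (n + w) - φ.logExt n) atTop (𝓝 0) := by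
  refine squeeze_zero_norm' (a := fun n : ℕ => 1 / (n : ℝ) * ‖w‖) ?_ ?_
  · filter_upwards [eventually_gt_atTop 0] with n hn
    have := φ.norm_logExt_sub_le hφ (u := n) (w := n) (z := n + w) (by positivity) (by simp)
      (by simpa)
    simpa using this
  · simpa using tendsto_one_div_atTop_nhds_zero_nat.mul_const ‖w‖

theorem sum_logTerm (n : ℕ) (hn : 0 < n) (z : ℂ) :
    ∑ k ∈ Finset.range n, φ.logTerm (k + 1) z =
      ∑ k ∈ Finset.range n, φ.logExt ((k + 1 : ℕ) : ℂ)
        - ∑ k ∈ Finset.range n, φ.logExt (((k + 1 : ℕ) : ℂ) + z) +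
        (φ.gammaSeq n + φ.logExt n) * z := by
  have h0 : (0 : ℝ) < n := by positivity
  have h1 : φ.logExt n = Real.log (φ.toFun n) := by
    simpa using φ.logExt_ofReal hφ h0
  have h2 : ∑ k ∈ Finset.Icc 1 n, φ.logDer k = ∑ k ∈ Finset.range n, φ.logDer ((k + 1 : ℕ) : ℝ) := by
    rw [Finset.range_eq_Ico, Finset.sum_Ico_add' (fun k : ℕ => φ.logDer k) 0 n 1]
    rfl
  rw [h1, gammaSeq, h2]
  simp only [logTerm, Finset.sum_add_distrib, Finset.sum_sub_distrib, ← Finset.sum_mul]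
  push_cast
  ring

/-- At z = 1 the sum of the logarithmic factors telescopes, so the partial sums differ from
`gammaSeq` by Log φ(1) and Log φ(n+1) - Log φ(n) → 0. The value of the limit is what makes W(1) = 1.
-/
theorem tendsto_gammaSeq_ofReal : Tendsto (fun n => (φ.gammaSeq n : ℂ)) atTop
    (𝓝 (∑' k : ℕ, φ.logTerm (k + 1) 1 - φ.logExt 1)) := by
  have h1 := (φ.summable_norm_logTerm hφ (z := 1) (by simp)).of_norm.hasSum.tendsto_sum_nat
  have h2 := (h1.sub_const (φ.logExt 1)).add (φ.tendsto_logExt_natCast_add hφ (w := 1) (by simp))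
  rw [add_zero] at h2
  refine h2.congr' ?_
  filter_upwards [eventually_gt_atTop 0] with n hn
  have h3 := Finset.sum_range_sub' (fun k : ℕ => φ.logExt ((k + 1 : ℕ) : ℂ)) n
  rw [φ.sum_logTerm hφ n hn, ← Finset.sum_sub_distrib]
  push_cast at h3 ⊢
  rw [h3]
  ring

theorem exists_tendsto_gammaSeq : ∃ g : ℝ, Tendsto φ.gammaSeq atTop (𝓝 g) :=
  ⟨_, (Complex.continuous_re.tendsto _).comp (φ.tendsto_gammaSeq_ofReal hφ)⟩

theorem tendsto_gammaSeq : Tendsto φ.gammaSeq atTop (𝓝 φ.gammaConst) :=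
  tendsto_nhds_limUnder (φ.exists_tendsto_gammaSeq hφ)

theorem gammaConst_eq : (φ.gammaConst : ℂ) = ∑' k : ℕ, φ.logTerm (k + 1) 1 - φ.logExt 1 :=
  tendsto_nhds_unique ((Complex.continuous_ofReal.tendsto _).comp (φ.tendsto_gammaSeq hφ))
    (φ.tendsto_gammaSeq_ofReal hφ)

theorem logW_one : φ.logW 1 = 0 := by
  rw [logW, φ.gammaConst_eq hφ]
  ring

/-- The logarithm of the Gauss product formula. -/
theorem tendsto_logW {w : ℂ} (hw : 0 < w.re) :
    Tendsto (fun n : ℕ => ∑ k ∈ Finset.range n, φ.logExt ((k + 1 : ℕ) : ℂ)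
        - ∑ k ∈ Finset.range (n + 1), φ.logExt (k + w) + φ.logExt n * w) atTop (𝓝 (φ.logW w)) := by
  have h1 := (φ.summable_norm_logTerm hφ hw.le).of_norm.hasSum.tendsto_sum_nat
  have h2 := (Complex.continuous_ofReal.tendsto _).comp (φ.tendsto_gammaSeq hφ)
  have h3 := ((h2.mul_const w).neg.sub_const (φ.logExt w)).add h1
  refine h3.congr' ?_
  filter_upwards [eventually_gt_atTop 0] with n hn
  -- The extra term k = 0 is the factor 1/φ(w) standing outside the product.
  rw [φ.sum_logTerm hφ n hn, Finset.sum_range_succ']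
  simp only [Function.comp_apply, Nat.cast_zero, zero_add]
  ring

/-- The Gauss approximants at z + 1 and z differ by Log φ(z), up to Log φ(n+1+z) - Log φ(n) → 0. -/
theorem logW_add_one {z : ℂ} (hz : 0 < z.re) : φ.logW (z + 1) = φ.logExt z + φ.logW z := by
  refine tendsto_nhds_unique (φ.tendsto_logW hφ (w := z + 1) (by simp; linarith)) ?_
  have h := ((tendsto_const_nhds (x := φ.logExt z)).add (φ.tendsto_logW hφ hz)).sub
    (φ.tendsto_logExt_natCast_add hφ (w := 1 + z) (by simp; linarith))
  rw [sub_zero] at h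
  refine h.congr fun n => ?_
  rw [Finset.sum_range_succ', Finset.sum_range_succ]
  have (k : ℕ) : φ.logExt (k + (z + 1)) = φ.logExt ((k + 1 : ℕ) + z) := by
    congr 1; push_cast; ring
  simp only [this]
  rw [show (n : ℂ) + (1 + z) = (n + 1 : ℕ) + z by push_cast; ring]
  simp only [Nat.cast_zero, zero_add]
  ring

theorem logW_add_one_eq {z : ℂ} (hz : 0 < z.re) :
    φ.logW (z + 1) = -(φ.gammaConst * z) + ∑' k : ℕ, φ.logTerm (k + 1) z := by
  rw [φ.logW_add_one hφ hz, logW]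
  ring

theorem factor_eq (k : ℕ) {z : ℂ} (hz : 0 ≤ z.re) :
    φ.factor (k + 1) z = Complex.exp (φ.logTerm (k + 1) z) := by
  rw [logTerm, Complex.exp_add, Complex.exp_sub, φ.exp_logExt hφ, φ.exp_logExt hφ, factor]
  · rw [Complex.add_re, Complex.natCast_re]; positivity
  · rw [Complex.natCast_re]; positivity

theorem summable_norm_factor_sub_one {z : ℂ} (hz : 0 ≤ z.re) :
    Summable fun k : ℕ => ‖φ.factor (k + 1) z - 1‖ := by
  have h := φ.summable_norm_logTerm hφ hz
  refine (h.mul_left 2).of_norm_bounded_eventually_nat ?_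
  filter_upwards [h.tendsto_atTop_zero.eventually_le_const one_pos] with k hk
  rw [norm_norm, φ.factor_eq hφ k hz]
  exact Complex.norm_exp_sub_one_le hk

theorem exp_logW {z : ℂ} (hz : 0 < z.re) : Complex.exp (φ.logW z) = φ.W z := by
  have h := (φ.summable_norm_logTerm hφ hz.le).of_norm.hasSum.cexp.tprod_eq
  rw [logW, Complex.exp_add, Complex.exp_sub, φ.exp_logExt hφ hz, W, ← h]
  congr 1
  exact tprod_congr fun k => (φ.factor_eq hφ k hz.le).symm

theorem isLogBranch_logW : IsLogBranch φ.W φ.logW :=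
  ⟨φ.analyticOnNhd_logW hφ, φ.logW_one hφ, fun _ hz => φ.exp_logW hφ hz⟩

theorem logBranch_eq {z : ℂ} (hz : 0 < z.re) : logBranch φ.W z = φ.logW z :=
  (φ.isLogBranch_logW hφ).logBranch.eqOn (φ.isLogBranch_logW hφ) hz

theorem WPow_eq (t : ℝ) {z : ℂ} (hz : 0 < z.re) : φ.WPow t z = Complex.exp (t * φ.logW z) := by
  rw [WPow, φ.logBranch_eq hφ hz]

theorem analyticOnNhd_WPow (t : ℝ) : AnalyticOnNhd ℂ (φ.WPow t) rightHalfPlane :=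
  (analyticOnNhd_const.mul (φ.isLogBranch_logW hφ).logBranch.1).cexp

theorem WPow_add_one (t : ℝ) {z : ℂ} (hz : 0 < z.re) :
    φ.WPow t (z + 1) = φ.extPow t z * φ.WPow t z := by
  rw [φ.WPow_eq hφ t hz, φ.WPow_eq hφ t (by simp; linarith), φ.logW_add_one hφ hz, extPow,
    ← Complex.exp_add, ← mul_add, logExt]

theorem WPow_one (t : ℝ) : φ.WPow t 1 = 1 := by
  rw [φ.WPow_eq hφ t (by simp), φ.logW_one hφ]
  simp

theorem analyticOnNhd_W : AnalyticOnNhd ℂ φ.W rightHalfPlane :=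
  (φ.analyticOnNhd_logW hφ).cexp.congr isOpen_rightHalfPlane fun _ hz => φ.exp_logW hφ hz

theorem W_add_one {z : ℂ} (hz : 0 < z.re) : φ.W (z + 1) = φ.ext z * φ.W z := by
  rw [← φ.exp_logW hφ hz, ← φ.exp_logW hφ (z := z + 1) (by simp; linarith), φ.logW_add_one hφ hz,
    Complex.exp_add, φ.exp_logExt hφ hz]

theorem W_one : φ.W 1 = 1 := by
  rw [← φ.exp_logW hφ (by simp), φ.logW_one hφ, Complex.exp_zero]

end BernsteinFunction

/-! ### Multipliers and positive definiteness of `W` -/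

/-- Multiplication by `g` preserves positive definiteness on the imaginary axis. -/
def IsPosDefMultiplier (g : ℂ → ℂ) : Prop :=
  ∀ f : ℂ → ℂ, IsPosDefOnImag f → IsPosDefOnImag fun s => f s * g s

namespace IsPosDefMultiplier

variable {f g : ℂ → ℂ}

theorem isPosDefOnImag (hg : IsPosDefMultiplier g) : IsPosDefOnImag g := by
  simpa using hg _ IsPosDefOnImag.one

theorem const {a : ℂ} (ha : 0 ≤ a) : IsPosDefMultiplier fun _ => a := fun f hf => by
  simpa [mul_comm] using hf.const_mul ha

theorem mul (hf : IsPosDefMultiplier f) (hg : IsPosDefMultiplier g) :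
    IsPosDefMultiplier fun s => f s * g s := fun h hh => by
  simpa [mul_assoc] using hg _ (hf h hh)

theorem add (hf : IsPosDefMultiplier f) (hg : IsPosDefMultiplier g) :
    IsPosDefMultiplier fun s => f s + g s := fun h hh => by
  simpa [mul_add] using (hf h hh).add (hg h hh)

theorem sum {ι : Type*} (t : Finset ι) {g : ι → ℂ → ℂ} (hg : ∀ i ∈ t, IsPosDefMultiplier (g i)) :
    IsPosDefMultiplier fun s => ∑ i ∈ t, g i s := by
  classical
  induction t using Finset.induction_on with
  | empty => simpa using const le_rfl
  | insert i t hi ih =>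
    simp only [Finset.sum_insert hi]
    exact (hg i (by simp)).add (ih fun j hj => hg j (by simp [hj]))

theorem prod {ι : Type*} (t : Finset ι) {g : ι → ℂ → ℂ} (hg : ∀ i ∈ t, IsPosDefMultiplier (g i)) :
    IsPosDefMultiplier fun s => ∏ i ∈ t, g i s := by
  classical
  induction t using Finset.induction_on with
  | empty => simpa using const zero_le_one
  | insert i t hi ih =>
    simp only [Finset.prod_insert hi]
    exact (hg i (by simp)).mul (ih fun j hj => hg j (by simp [hj]))

theorem pow (hg : IsPosDefMultiplier g) (n : ℕ) : IsPosDefMultiplier fun s => g s ^ n := by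
  simpa using prod (Finset.range n) fun _ _ => hg

theorem exp_mul (y : ℝ) : IsPosDefMultiplier fun s => Complex.exp (y * s) := fun _ hf => hf.exp_mul y

theorem of_tendsto {ι : Type*} {l : Filter ι} [l.NeBot] {F : ι → ℂ → ℂ}
    (hF : ∀ᶠ i in l, IsPosDefMultiplier (F i))
    (h : ∀ s : ℂ, s.re = 0 → Tendsto (fun i => F i s) l (𝓝 (g s))) : IsPosDefMultiplier g :=
  fun f hf => IsPosDefOnImag.of_tendsto (hF.mono fun _ hi => hi f hf)
    fun s hs => tendsto_const_nhds.mul (h s hs)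

theorem integral_exp {m : Measure ℝ} [IsFiniteMeasure m] (hm : ∀ᵐ y ∂m, 0 ≤ y) {a : ℝ} (ha : 0 ≤ a) :
    IsPosDefMultiplier fun s => ∫ y : ℝ, Complex.exp (-((a + s) * y)) ∂m := by
  intro f hf
  rw [isPosDefOnImag_iff]
  intro n s c hs
  have hint (i j : Fin n) : Integrable (fun y : ℝ => Complex.exp (-((a + (s i - s j)) * y))) m := by
    refine (integrable_const (1 : ℝ)).mono' (by fun_prop) ?_
    filter_upwards [hm] with y hy
    rw [Complex.norm_exp, Real.exp_le_one_iff, Complex.neg_re, Complex.re_mul_ofReal]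
    simp only [Complex.add_re, Complex.sub_re, hs, Complex.ofReal_re, sub_zero, add_zero]
    nlinarith
  have h (y : ℝ) : 0 ≤ ∑ i, ∑ j, f (s i - s j) * Complex.exp (-((a + (s i - s j)) * y)) * c i *
      conj (c j) := by
    refine (isPosDefOnImag_iff.1 ((hf.exp_mul (-y)).const_mul
      (Complex.zero_le_real.2 (Real.exp_pos (-(a * y))).le)) n s c hs).trans_eq ?_
    refine Finset.sum_congr rfl fun i _ => Finset.sum_congr rfl fun j _ => ?_
    have : Complex.exp (-((a + (s i - s j)) * y)) =
        Real.exp (-(a * y)) * Complex.exp (((-y : ℝ) : ℂ) * (s i - s j)) := by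
      rw [Complex.ofReal_exp, ← Complex.exp_add]
      congr 1
      push_cast
      ring
    rw [this]
    ring
  have e : ∑ i, ∑ j, f (s i - s j) * (∫ y : ℝ, Complex.exp (-((a + (s i - s j)) * y)) ∂m) * c i *
      conj (c j) = ∫ y : ℝ, ∑ i, ∑ j, f (s i - s j) * Complex.exp (-((a + (s i - s j)) * y)) * c i *
      conj (c j) ∂m := by
    rw [integral_finsetSum _ fun i _ => integrable_finsetSum _ fun j _ =>
      (((hint i j).const_mul _).mul_const _).mul_const _]
    refine Finset.sum_congr rfl fun i _ => ?_
    rw [integral_finsetSum _ fun j _ => (((hint i j).const_mul _).mul_const _).mul_const _]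
    refine Finset.sum_congr rfl fun j _ => ?_
    rw [integral_mul_const, integral_mul_const, integral_const_mul]
  rw [e]
  exact integral_nonneg h

/-- If `‖g‖ < c` on the imaginary axis, then `1 / (c - g) = ∑ g ^ n / c ^ (n + 1)`. -/
theorem inv_sub {c : ℝ} (hg : IsPosDefMultiplier g) (hc : 0 < c)
    (h : ∀ s : ℂ, s.re = 0 → ‖g s‖ < c) : IsPosDefMultiplier fun s => (c - g s)⁻¹ := by
  have hc' : (0 : ℂ) ≤ (c : ℂ)⁻¹ := by
    rw [← Complex.ofReal_inv]; exact Complex.zero_le_real.2 (by positivity)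
  have h1 (N : ℕ) : IsPosDefMultiplier fun s =>
      (c : ℂ)⁻¹ * ∑ n ∈ Finset.range N, ((c : ℂ)⁻¹ * g s) ^ n :=
    (const hc').mul (sum _ fun n _ => ((const hc').mul hg).pow n)
  refine of_tendsto (l := atTop) (Eventually.of_forall h1) fun s hs => ?_
  have hc0 : (c : ℂ) ≠ 0 := by exact_mod_cast hc.ne'
  have hlt : ‖(c : ℂ)⁻¹ * g s‖ < 1 := by
    rw [norm_mul, norm_inv, Complex.norm_real, Real.norm_of_nonneg hc.le, inv_mul_lt_one₀ hc]
    exact h s hs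
  have := ((hasSum_geometric_of_norm_lt_one hlt).tendsto_sum_nat).const_mul (c : ℂ)⁻¹
  rwa [← mul_inv, mul_sub, mul_one, mul_inv_cancel_left₀ hc0] at this

end IsPosDefMultiplier

namespace BernsteinFunction

variable (φ : BernsteinFunction)

/-- Approximation of `φ` by Bernstein functions with finite Lévy measure and no drift. -/
noncomputable def approx (n : ℕ) (z : ℂ) : ℂ :=
  φ.killing + φ.drift * ((n + 1 : ℕ) * (1 - Complex.exp (-(z * (1 / (n + 1 : ℕ) : ℝ)))))
    + ∫ y in Ioi (1 / (n + 1 : ℕ) : ℝ), (1 - Complex.exp (-(z * y))) ∂φ.levy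

/-- The drift is replaced by a difference quotient of 1 - e^{-zh} at h = 0, and the small jumps are
cut off. -/
theorem tendsto_approx {z : ℂ} (hz : 0 ≤ z.re) :
    Tendsto (fun n => φ.approx n z) atTop (𝓝 (φ.ext z)) := by
  refine (tendsto_const_nhds.add (tendsto_const_nhds.mul ?_)).add ?_
  · have hd : HasDerivAt (fun h : ℂ => 1 - Complex.exp (-(z * h))) z 0 := by
      have : HasDerivAt (fun h : ℂ => -(z * h)) (-(z * 1)) 0 := ((hasDerivAt_id _).const_mul z).neg
      simpa using this.cexp.const_sub 1
    have ht := (hasDerivAt_iff_tendsto_slope_zero.1 hd)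
    have hn : Tendsto (fun n : ℕ => (((1 / (n + 1 : ℕ) : ℝ)) : ℂ)) atTop (𝓝[≠] 0) := by
      refine tendsto_nhdsWithin_of_tendsto_nhds_of_eventually_within _ ?_
        (Eventually.of_forall fun n => ?_)
      · have := (Complex.continuous_ofReal.tendsto _).comp (tendsto_one_div_add_atTop_nhds_zero_nat (𝕜 := ℝ))
        simpa [Function.comp_def] using this
      · have : (0 : ℝ) < 1 / (n + 1 : ℕ) := by positivity
        exact Complex.ofReal_ne_zero.2 this.ne'
    refine (ht.comp hn).congr fun n => ?_
    simp
  · have hU : (⋃ n : ℕ, Ioi (1 / (n + 1 : ℕ) : ℝ)) = Ioi 0 := by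
      ext y
      simp only [mem_iUnion, mem_Ioi]
      constructor
      · rintro ⟨n, hn⟩
        exact lt_trans (by positivity) hn
      · intro hy
        obtain ⟨n, hn⟩ := exists_nat_one_div_lt hy
        exact ⟨n, by simpa using hn⟩
    have := tendsto_setIntegral_of_monotone (μ := φ.levy)
      (f := fun y : ℝ => 1 - Complex.exp (-(z * y)))
      (s := fun n : ℕ => Ioi (1 / (n + 1 : ℕ) : ℝ)) (fun n => measurableSet_Ioi)
      (fun m n hmn => Ioi_subset_Ioi (by gcongr)) (by
        rw [hU]; exact φ.integrable_one_sub_cexp hz)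
    rwa [hU] at this

theorem levy_Ioi_lt_top {r : ℝ} (hr : 0 < r) : φ.levy (Ioi r) < ∞ := by
  have hε : ENNReal.ofReal (min 1 r) ≠ 0 := by simp [hr]
  have h := meas_ge_le_lintegral_div (μ := φ.levy)
    (f := fun y => ENNReal.ofReal (min 1 y)) (by fun_prop) hε ENNReal.ofReal_ne_top
  refine (measure_mono fun y hy => ?_).trans_lt
    (h.trans_lt (ENNReal.div_lt_top φ.levy_int.ne hε))
  exact ENNReal.ofReal_le_ofReal (min_le_min_left _ (le_of_lt hy))

/-- On a + iℝ the approximant is c - g, with c the killing rate plus the total jump mass and g the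
Laplace transform of the jump measure. There |g(s)| ≤ g(0) < c, so the geometric series for 1/(c -
g) applies. -/
theorem isPosDefMultiplier_inv_approx {a : ℝ} (ha : 0 < a) {n : ℕ} (h : 0 < (φ.approx n a).re) :
    IsPosDefMultiplier fun s => (φ.approx n (a + s))⁻¹ := by
  set q : ℝ := 1 / (n + 1 : ℕ) with hq
  have hq0 : 0 < q := by positivity
  have : IsFiniteMeasure (φ.levy.restrict (Ioi q)) :=
    ⟨by simpa using φ.levy_Ioi_lt_top hq0⟩
  set D : ℝ := φ.drift * (n + 1 : ℕ) with hD
  have hD0 : 0 ≤ D := mul_nonneg φ.drift_nonneg (by positivity)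
  set M : ℝ := (φ.levy.restrict (Ioi q)).real univ with hM
  have hpos : ∀ᵐ y ∂(φ.levy.restrict (Ioi q)), 0 ≤ y := by
    filter_upwards [ae_restrict_mem measurableSet_Ioi] with y hy using (hq0.trans hy).le
  set g : ℂ → ℂ := fun s => D * Complex.exp (-((a + s) * q)) +
    ∫ y in Ioi q, Complex.exp (-((a + s) * y)) ∂φ.levy with hg
  have hnorm {s : ℂ} (hs : s.re = 0) (y : ℝ) :
      ‖Complex.exp (-((a + s) * y))‖ = Real.exp (-(a * y)) := by
    rw [Complex.norm_exp]
    simp [hs]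
  have hint {s : ℂ} (hs : s.re = 0) :
      Integrable (fun y : ℝ => Complex.exp (-((a + s) * y))) (φ.levy.restrict (Ioi q)) := by
    refine (integrable_const (1 : ℝ)).mono' (by fun_prop) ?_
    filter_upwards [hpos] with y hy
    rw [hnorm hs, Real.exp_le_one_iff]
    nlinarith
  have happ {s : ℂ} (hs : s.re = 0) :
      φ.approx n (a + s) = ((φ.killing + D + M : ℝ) : ℂ) - g s := by
    rw [approx, ← hq, integral_sub (integrable_const _) (hint hs), integral_const, hg, hD, hM]
    simp only [Complex.real_smul]
    push_cast
    ring
  have hgm : IsPosDefMultiplier g := by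
    refine IsPosDefMultiplier.add ((IsPosDefMultiplier.const (Complex.zero_le_real.2 hD0)).mul ?_)
      (IsPosDefMultiplier.integral_exp hpos ha.le)
    have := (IsPosDefMultiplier.const (Complex.zero_le_real.2 (Real.exp_pos (-(a * q))).le)).mul
      (IsPosDefMultiplier.exp_mul (-q))
    convert this using 2 with s
    rw [Complex.ofReal_exp, ← Complex.exp_add]
    congr 1
    push_cast
    ring
  have hg0 : (g 0).re = D * Real.exp (-(a * q)) + ∫ y in Ioi q, Real.exp (-(a * y)) ∂φ.levy := by
    have : g 0 = ((D * Real.exp (-(a * q)) + ∫ y in Ioi q, Real.exp (-(a * y)) ∂φ.levy : ℝ) : ℂ) := by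
      simp only [hg, add_zero, Complex.ofReal_add, ← integral_complex_ofReal]
      simp
    rw [this, Complex.ofReal_re]
  have hgle (s : ℂ) (hs : s.re = 0) : ‖g s‖ ≤ (g 0).re := by
    rw [hg0]
    refine (norm_add_le _ _).trans (add_le_add ?_ ?_)
    · rw [norm_mul, hnorm hs, Complex.norm_real, Real.norm_of_nonneg hD0]
    · refine (norm_integral_le_integral_norm _).trans_eq (integral_congr_ae ?_)
      exact Eventually.of_forall fun y => hnorm hs y
  have h0 := happ (s := 0) (by simp)
  rw [add_zero] at h0
  rw [h0, Complex.sub_re, Complex.ofReal_re, sub_pos] at h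
  have hlt (s : ℂ) (hs : s.re = 0) : ‖g s‖ < φ.killing + D + M := (hgle s hs).trans_lt h
  have := hgm.inv_sub ((norm_nonneg _).trans_lt (hlt 0 (by simp))) hlt
  -- A constant limit serves as congruence: the two functions need agree only on the imaginary axis.
  exact IsPosDefMultiplier.of_tendsto (l := (⊤ : Filter Unit)) (Eventually.of_forall fun _ => this)
    fun s hs => by rw [happ hs]; exact tendsto_const_nhds

variable (hφ : ∃ u : ℝ, 0 ≤ u ∧ φ.toFun u ≠ 0)
include hφ

theorem isPosDefMultiplier_inv_ext {a : ℝ} (ha : 0 < a) :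
    IsPosDefMultiplier fun s => (φ.ext (a + s))⁻¹ := by
  refine IsPosDefMultiplier.of_tendsto (l := atTop) (F := fun n s => (φ.approx n (a + s))⁻¹) ?_ ?_
  · have h := (Complex.continuous_re.tendsto _).comp (φ.tendsto_approx (z := a) (by simpa using ha.le))
    filter_upwards [h.eventually_const_lt (φ.re_ext_pos hφ (z := a) (by simpa))] with n hn
    exact φ.isPosDefMultiplier_inv_approx ha hn
  · intro s hs
    have hre : (a + s : ℂ).re = a := by simp [hs]
    exact (φ.tendsto_approx (by rw [hre]; exact ha.le)).inv₀ (φ.ext_ne_zero hφ (by rwa [hre]))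

theorem isPosDefOnImag_W : IsPosDefOnImag fun s => φ.W (1 + s) := by
  -- The Gauss product at 1 + s, with φ(n)^{1+s} split as φ(n) e^{s log φ(n)} so that every factor
  -- is visibly a multiplier.
  set F : ℕ → ℂ → ℂ := fun n s => (∏ k ∈ Finset.range n, φ.ext ((k + 1 : ℕ) : ℝ)) *
    (∏ k ∈ Finset.range (n + 1), (φ.ext (((k + 1 : ℕ) : ℝ) + s))⁻¹) *
    (φ.ext (n : ℝ) * Complex.exp (Real.log (φ.toFun n) * s)) with hF
  have hext {u : ℝ} (hu : 0 < u) : 0 ≤ φ.ext u := by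
    rw [ext_ofReal]; exact Complex.zero_le_real.2 (φ.toFun_pos hφ hu).le
  refine IsPosDefOnImag.of_tendsto (l := atTop) (F := F) ?_ fun s hs => ?_
  · filter_upwards [eventually_gt_atTop 0] with n hn
    refine IsPosDefMultiplier.isPosDefOnImag (((IsPosDefMultiplier.const ?_).mul
      (IsPosDefMultiplier.prod _ fun k _ => φ.isPosDefMultiplier_inv_ext hφ (by positivity))).mul
      ((IsPosDefMultiplier.const (hext (by positivity))).mul (IsPosDefMultiplier.exp_mul _)))
    exact Finset.prod_nonneg fun k _ => hext (by positivity)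
  · have hs1 : 0 < (1 + s).re := by simp [hs]
    have h := (φ.tendsto_logW hφ hs1).cexp
    rw [φ.exp_logW hφ hs1] at h
    refine h.congr' ?_
    filter_upwards [eventually_gt_atTop 0] with n hn
    have hn0 : (0 : ℝ) < n := by positivity
    have e1 : φ.logExt n = Real.log (φ.toFun n) := by simpa using φ.logExt_ofReal hφ hn0
    rw [Complex.exp_add, Complex.exp_sub, Complex.exp_sum, Complex.exp_sum, mul_add, mul_one,
      Complex.exp_add, φ.exp_logExt hφ (by simpa using hn0), e1, hF, div_eq_mul_inv,
      ← Finset.prod_inv_distrib]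
    simp only [Complex.ofReal_natCast]
    congr 2
    · refine Finset.prod_congr rfl fun k _ => φ.exp_logExt hφ ?_
      rw [Complex.natCast_re]; positivity
    · refine Finset.prod_congr rfl fun k _ => ?_
      rw [φ.exp_logExt hφ (by simp [hs]; positivity)]
      congr 2
      push_cast
      ring

theorem eqOn_W {G : ℂ → ℂ} (hG : AnalyticOnNhd ℂ G rightHalfPlane)
    (hpd : IsPosDefOnImag fun s => G (1 + s))
    (hfe : ∀ z ∈ rightHalfPlane, G (z + 1) = φ.ext z * G z) (h1 : G 1 = 1) :
    EqOn G φ.W rightHalfPlane := by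
  refine hpd.unique_solution hG (φ.analyticOnNhd_W hφ) (φ.isPosDefOnImag_W hφ) (φ := φ.ext) ?_ ?_
    hfe (fun z hz => φ.W_add_one hφ hz) h1 (φ.W_one hφ)
  · intro x hx
    rw [ext_ofReal]
    exact Complex.pos_iff.2 (by simpa using φ.toFun_pos hφ hx)
  · have h := (Complex.continuous_re.tendsto _).comp
      (φ.tendsto_logExt_natCast_add hφ (w := 1) (by simp))
    refine h.congr' ?_
    filter_upwards [eventually_gt_atTop 0] with n hn
    have hn0 : (0 : ℝ) < n := by positivity
    have e1 : φ.logExt n = Real.log (φ.toFun n) := by simpa using φ.logExt_ofReal hφ hn0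
    have e2 : φ.logExt (n + 1) = Real.log (φ.toFun (n + 1)) := by
      simpa using φ.logExt_ofReal hφ (u := n + 1) (by positivity)
    simp only [Function.comp_apply, e1, e2, ext_ofReal]
    simp

end BernsteinFunction

/-! ### The measure κ and the exponent Ψ -/

namespace BernsteinFunction

variable (φ : BernsteinFunction) {κ : Measure ℝ}

theorem logDer_nonneg (hφ : ∃ u : ℝ, 0 ≤ u ∧ φ.toFun u ≠ 0) {u : ℝ} (hu : 0 < u) :
    0 ≤ φ.logDer u := by
  rw [logDer, (φ.hasDerivAt_toFun hu).deriv, extDeriv_ofReal, Complex.ofReal_re]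
  refine div_nonneg (add_nonneg φ.drift_nonneg ?_) (φ.toFun_pos hφ hu).le
  exact setIntegral_nonneg measurableSet_Ioi fun y hy =>
    mul_nonneg (le_of_lt hy) (Real.exp_pos _).le

theorem hasDerivAt_log_toFun (hφ : ∃ u : ℝ, 0 ≤ u ∧ φ.toFun u ≠ 0) {u : ℝ} (hu : 0 < u) :
    HasDerivAt (fun u => Real.log (φ.toFun u)) (φ.logDer u) u := by
  have h := φ.hasDerivAt_toFun hu
  have := h.log (φ.toFun_pos hφ hu).ne'
  rwa [← h.deriv] at this

namespace IsKappa

variable {φ} (hκ : φ.IsKappa κ)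
include hκ

theorem restrict_Ioi : κ.restrict (Ioi 0) = κ := by
  refine Measure.restrict_eq_self_of_ae_mem ?_
  rw [ae_iff]
  convert hκ.1 using 2
  ext y
  simp

theorem ae_pos : ∀ᵐ y ∂κ, 0 < y := by
  rw [← hκ.restrict_Ioi]
  exact ae_restrict_mem measurableSet_Ioi

theorem integrable_exp {u : ℝ} (hu : 0 < u) : Integrable (fun y : ℝ => Real.exp (-(u * y))) κ := by
  refine ⟨by fun_prop, ?_⟩
  rw [hasFiniteIntegral_iff_ofReal (Eventually.of_forall fun y => (Real.exp_pos _).le), hκ.2 u hu]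
  exact ENNReal.ofReal_lt_top

theorem integral_exp (hφ : ∃ u : ℝ, 0 ≤ u ∧ φ.toFun u ≠ 0) {u : ℝ} (hu : 0 < u) :
    ∫ y : ℝ, Real.exp (-(u * y)) ∂κ = φ.logDer u := by
  rw [integral_eq_lintegral_of_nonneg_ae (Eventually.of_forall fun y => (Real.exp_pos _).le)
    (by fun_prop), hκ.2 u hu, ENNReal.toReal_ofReal (φ.logDer_nonneg hφ hu)]

theorem integrable_frullani {k x : ℝ} (hk : 0 < k) (hx : 0 ≤ x) :
    Integrable (fun y : ℝ => Real.exp (-(k * y)) * (1 - Real.exp (-(x * y))) / y) κ := by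
  refine ((hκ.integrable_exp hk).const_mul x).mono' (Measurable.aestronglyMeasurable (by fun_prop)) ?_
  filter_upwards [hκ.ae_pos] with y hy
  have h1 := Real.exp_pos (-(k * y))
  have h2 := Real.add_one_le_exp (-(x * y))
  have h3 : Real.exp (-(x * y)) ≤ 1 := by rw [Real.exp_le_one_iff]; nlinarith
  have h4 : 0 ≤ 1 - Real.exp (-(x * y)) := by linarith
  rw [Real.norm_of_nonneg (by positivity), div_le_iff₀ hy]
  nlinarith

/-- Both sides vanish at x = 0 and have x-derivative (φ'/φ)(k + x), the Laplace transform of κ at k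
+ x. -/
theorem integral_frullani (hφ : ∃ u : ℝ, 0 ≤ u ∧ φ.toFun u ≠ 0) {k x : ℝ} (hk : 0 < k) (hx : 0 ≤ x) :
    ∫ y : ℝ, Real.exp (-(k * y)) * (1 - Real.exp (-(x * y))) / y ∂κ =
      Real.log (φ.toFun (k + x)) - Real.log (φ.toFun k) := by
  have hd {x : ℝ} (hx : 0 ≤ x) :
      HasDerivAt (fun x => ∫ y : ℝ, Real.exp (-(k * y)) * (1 - Real.exp (-(x * y))) / y ∂κ)
        (φ.logDer (k + x)) x := by
    rw [← hκ.integral_exp hφ (by linarith : 0 < k + x)]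
    refine (hasDerivAt_integral_of_dominated_loc_of_deriv_le
      (F' := fun x y => Real.exp (-((k + x) * y)))
      (bound := fun y => Real.exp (-(k / 2 * y)))
      (Ioi_mem_nhds (show -(k / 2) < x by linarith)) (Eventually.of_forall fun x =>
        Measurable.aestronglyMeasurable (by fun_prop))
      (hκ.integrable_frullani hk hx) (by fun_prop) ?_ (hκ.integrable_exp (half_pos hk)) ?_).2
    · filter_upwards [hκ.ae_pos] with y hy x hx
      rw [Real.norm_of_nonneg (Real.exp_pos _).le, Real.exp_le_exp]
      have : -(k / 2) < x := hx
      nlinarith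
    · filter_upwards [hκ.ae_pos] with y hy x _
      have h1 : HasDerivAt (fun x : ℝ => -(x * y)) (-(1 * y)) x := ((hasDerivAt_id x).mul_const y).neg
      have h2 := ((h1.exp.const_sub 1).const_mul (Real.exp (-(k * y)))).div_const y
      refine h2.congr_deriv ?_
      rw [add_mul, neg_add, Real.exp_add]
      field_simp
  have hd' (x : ℝ) (hx : x ∈ Ici (0 : ℝ)) : HasDerivWithinAt
      (fun x => (∫ y : ℝ, Real.exp (-(k * y)) * (1 - Real.exp (-(x * y))) / y ∂κ) -
        Real.log (φ.toFun (k + x))) 0 (Ici 0) x := by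
    have h0 : 0 < k + x := by have : 0 ≤ x := hx; linarith
    have h1 := (φ.hasDerivAt_log_toFun hφ h0).comp_const_add k x
    exact (((hd hx).sub h1).congr_deriv (sub_self _)).hasDerivWithinAt
  have := (convex_Ici (0 : ℝ)).norm_image_sub_le_of_norm_hasDerivWithin_le (C := 0) hd'
    (fun _ _ => by simp) (x := 0) (y := x) self_mem_Ici hx
  simp only [zero_mul, norm_le_zero_iff, neg_zero, Real.exp_zero, sub_self, mul_zero, zero_div,
    integral_zero, add_zero, zero_sub] at this
  linarith

/-- Expand 1/(e^y - 1) = ∑ e^{-(k+1)y}. The k-th integral is a combination of logarithmic factors at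
x and 1 in which φ'/φ cancels. -/
theorem Psi_ofReal (hφ : ∃ u : ℝ, 0 ≤ u ∧ φ.toFun u ≠ 0) {x : ℝ} (hx : 1 ≤ x) :
    φ.Psi κ x = φ.logW (x + 1) := by
  have hx0 : 0 < x := by linarith
  set g : ℕ → ℝ → ℝ := fun k y =>
    x * (Real.exp (-((k + 1 : ℕ) * y)) * (1 - Real.exp (-(1 * y))) / y) -
      Real.exp (-((k + 1 : ℕ) * y)) * (1 - Real.exp (-(x * y))) / y with hg
  have hk (k : ℕ) : (0 : ℝ) < (k + 1 : ℕ) := by positivity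
  have hgint (k : ℕ) : Integrable (g k) κ :=
    ((hκ.integrable_frullani (hk k) zero_le_one).const_mul x).sub
      (hκ.integrable_frullani (hk k) hx0.le)
  have hgval (k : ℕ) : ((∫ y, g k y ∂κ : ℝ) : ℂ) = φ.logTerm (k + 1) x - x * φ.logTerm (k + 1) 1 := by
    have e1 : φ.logExt ((k + 1 : ℕ) : ℂ) = Real.log (φ.toFun (k + 1 : ℕ)) := by
      simpa using φ.logExt_ofReal hφ (hk k)
    have e2 {u : ℝ} (hu : 0 ≤ u) : φ.logExt ((k + 1 : ℕ) + u) = Real.log (φ.toFun ((k + 1 : ℕ) + u)) := by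
      simpa using φ.logExt_ofReal hφ (u := (k + 1 : ℕ) + u) (by linarith [hk k])
    have e3 := e2 zero_le_one
    rw [Complex.ofReal_one] at e3
    rw [hg, integral_sub ((hκ.integrable_frullani (hk k) zero_le_one).const_mul x)
      (hκ.integrable_frullani (hk k) hx0.le), integral_const_mul,
      hκ.integral_frullani hφ (hk k) zero_le_one, hκ.integral_frullani hφ (hk k) hx0.le,
      logTerm, logTerm, e1, e2 hx0.le, e3]
    push_cast
    ring
  -- Bernoulli's inequality for (e^{-y})^x, the reason for x ≥ 1. Positivity makes the series of
  -- integrals absolutely summable, permitting the exchange of sum and integral.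
  have hgnonneg (k : ℕ) : ∀ᵐ y ∂κ, 0 ≤ g k y := by
    filter_upwards [hκ.ae_pos] with y hy
    have h1 := one_add_mul_self_le_rpow_one_add (s := Real.exp (-y) - 1)
      (by linarith [Real.exp_pos (-y)]) hx
    rw [add_sub_cancel, ← Real.exp_mul, show -y * x = -(x * y) by ring] at h1
    have h2 := Real.exp_pos (-((k + 1 : ℕ) * y))
    have : g k y = Real.exp (-((k + 1 : ℕ) * y)) *
        (Real.exp (-(x * y)) - (1 + x * (Real.exp (-y) - 1))) / y := by
      simp only [hg, one_mul]
      ring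
    rw [this]
    have h3 := sub_nonneg.2 h1
    positivity
  have hs1 := (φ.summable_norm_logTerm hφ (z := x) (by simpa using hx0.le)).of_norm
  have hs2 := (φ.summable_norm_logTerm hφ (z := 1) (by simp)).of_norm
  have hsum : Summable fun k => ∫ y, ‖g k y‖ ∂κ := by
    have := hs1.sub (hs2.mul_left (x : ℂ))
    simp_rw [← hgval] at this
    refine (Complex.summable_ofReal.1 this).congr fun k => integral_congr_ae ?_
    filter_upwards [hgnonneg k] with y hy using (Real.norm_of_nonneg hy).symm
  have hmain := hasSum_integral_of_summable_integral_norm hgint hsum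
  have hmain' : HasSum (fun k => φ.logTerm (k + 1) x - x * φ.logTerm (k + 1) 1)
      ((∫ y, ∑' k, g k y ∂κ : ℝ) : ℂ) := by
    simpa only [hgval] using Complex.hasSum_ofReal.2 hmain
  have hval := hmain'.unique (hs1.hasSum.sub (hs2.hasSum.mul_left (x : ℂ)))
  have htsum : ∀ᵐ y : ℝ ∂κ, (Complex.exp (-((x : ℂ) * y)) - 1 - x * (Complex.exp (-(y : ℂ)) - 1)) /
      (y * (Complex.exp y - 1)) = ((∑' k, g k y : ℝ) : ℂ) := by
    filter_upwards [hκ.ae_pos] with y hy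
    have hq0 := Real.exp_pos (-y)
    have hq1 : Real.exp (-y) < 1 := by rw [Real.exp_lt_one_iff]; linarith
    have h1 := ((hasSum_geometric_of_lt_one hq0.le hq1).mul_left (Real.exp (-y) *
        ((Real.exp (-(x * y)) - 1 - x * (Real.exp (-y) - 1)) / y)))
    have h2 : HasSum (fun k => g k y) _ := h1.congr_fun fun k => by
      simp only [hg]
      rw [show -(((k + 1 : ℕ) : ℝ) * y) = k * (-y) + -y by push_cast; ring, Real.exp_add,
        Real.exp_nat_mul, one_mul]
      ring
    rw [h2.tsum_eq]
    have h3 : Real.exp y * Real.exp (-y) = 1 := by rw [← Real.exp_add]; simp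
    have h4 : (1 - Real.exp (-y)) ≠ 0 := by linarith
    have h5 : Real.exp y - 1 ≠ 0 := by
      have : 1 < Real.exp y := Real.one_lt_exp_iff.2 hy
      linarith
    have h6 : (Real.exp (-(x * y)) - 1 - x * (Real.exp (-y) - 1)) / (y * (Real.exp y - 1)) =
        Real.exp (-y) * ((Real.exp (-(x * y)) - 1 - x * (Real.exp (-y) - 1)) / y) *
          (1 - Real.exp (-y))⁻¹ := by
      field_simp
      linear_combination (-(Real.exp (-(x * y)) - 1 - x * (Real.exp (-y) - 1))) * h3
    rw [← h6]
    push_cast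
    rfl
  rw [Psi, hκ.restrict_Ioi, integral_congr_ae htsum, integral_complex_ofReal, hval,
    φ.logW_add_one_eq hφ (by simpa using hx0), φ.gammaConst_eq hφ,
    show (φ.logExt 1) = Real.log (φ.toFun 1) by simpa using φ.logExt_ofReal hφ one_pos]
  ring

end IsKappa

end BernsteinFunction

/-! ### Landau's theorem and the moments of the semigroup -/

open ProbabilityTheory in
/-- Landau's theorem: if the moment generating function of `X` extends analytically to a disc, then
the exponential moments of `X` exist in this disc. -/
theorem mem_integrableExpSet_of_differentiableOn {Ω : Type*} [MeasurableSpace Ω] {X : Ω → ℝ}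
    {m : Measure Ω} {a r : ℝ} (ha : a ∈ interior (integrableExpSet X m)) {h : ℂ → ℂ}
    (hd : DifferentiableOn ℂ h (Metric.ball a r)) (he : complexMGF X m =ᶠ[𝓝 (a : ℂ)] h)
    {s : ℝ} (hs : |s| < r) : a + s ∈ integrableExpSet X m := by
  have hX : AEMeasurable X m := aemeasurable_of_mem_interior_integrableExpSet ha
  have hint (n : ℕ) : Integrable (fun ω => X ω ^ n * Real.exp (a * X ω)) m :=
    integrable_pow_mul_exp_of_mem_interior_integrableExpSet ha n
  have hder (n : ℕ) : iteratedDeriv n h a = ((∫ ω, X ω ^ n * Real.exp (a * X ω) ∂m : ℝ) : ℂ) := by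
    rw [← he.iteratedDeriv_eq, iteratedDeriv_complexMGF (by simpa), ← integral_complex_ofReal]
    simp
  -- Even powers of X are nonnegative, so Tonelli applies; the even part of the series sums to 2
  -- cosh(sX) e^{aX}, which dominates e^{(a+s)X}.
  have h1 := hasSum_taylorSeries_even hd (w := s) (by simpa)
  simp only [hder] at h1
  set b : ℕ → ℝ := fun n => 2 * (((2 * n).factorial : ℝ)⁻¹ * (s ^ (2 * n) *
    ∫ ω, X ω ^ (2 * n) * Real.exp (a * X ω) ∂m)) with hb
  have h2 : Summable b := by
    refine Complex.summable_ofReal.1 (h1.summable.congr fun n => ?_)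
    simp [hb]
  set G : ℕ → Ω → ℝ := fun n ω => 2 * (((2 * n).factorial : ℝ)⁻¹ * (s ^ (2 * n) *
    (X ω ^ (2 * n) * Real.exp (a * X ω)))) with hG
  have hG0 (n : ℕ) (ω : Ω) : 0 ≤ G n ω := by
    simp only [hG, pow_mul]
    positivity
  have hGint (n : ℕ) : Integrable (G n) m :=
    (((hint (2 * n)).const_mul _).const_mul _).const_mul _
  have hGb (n : ℕ) : ∫⁻ ω, ENNReal.ofReal (G n ω) ∂m = ENNReal.ofReal (b n) := by
    rw [← ofReal_integral_eq_lintegral_ofReal (hGint n) (Eventually.of_forall (hG0 n))]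
    simp only [hG, hb, integral_const_mul]
  have hsum (ω : Ω) : HasSum (fun n => G n ω)
      (2 * Real.cosh (s * X ω) * Real.exp (a * X ω)) := by
    refine (((Real.hasSum_cosh (s * X ω)).mul_left 2).mul_right (Real.exp (a * X ω))).congr_fun
      fun n => ?_
    simp only [hG, mul_pow]
    ring
  have hfin : ∫⁻ ω, ENNReal.ofReal (2 * Real.cosh (s * X ω) * Real.exp (a * X ω)) ∂m < ∞ := by
    have e (ω : Ω) : ENNReal.ofReal (2 * Real.cosh (s * X ω) * Real.exp (a * X ω)) =
        ∑' n, ENNReal.ofReal (G n ω) := by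
      rw [← (hsum ω).tsum_eq, ENNReal.ofReal_tsum_of_nonneg (fun n => hG0 n ω) (hsum ω).summable]
    simp_rw [e]
    rw [lintegral_tsum fun n => (hGint n).aemeasurable.ennreal_ofReal]
    simp_rw [hGb]
    rw [← ENNReal.ofReal_tsum_of_nonneg ?_ h2]
    · exact ENNReal.ofReal_lt_top
    · intro n
      simp only [hb, pow_mul]
      have : 0 ≤ ∫ ω, (X ω ^ 2) ^ n * Real.exp (a * X ω) ∂m := integral_nonneg fun ω => by
        simp only [Pi.zero_apply]; positivity
      positivity
  refine ⟨by fun_prop, ?_⟩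
  rw [hasFiniteIntegral_iff_ofReal (Eventually.of_forall fun ω => (Real.exp_pos _).le)]
  refine (lintegral_mono fun ω => ENNReal.ofReal_le_ofReal ?_).trans_lt hfin
  rw [add_mul, Real.exp_add, mul_comm, Real.cosh_eq]
  have := Real.exp_pos (-(s * X ω))
  have := Real.exp_pos (a * X ω)
  nlinarith

theorem complexMGF_log_restrict (ρ : Measure ℝ) (z : ℂ) :
    ProbabilityTheory.complexMGF Real.log (ρ.restrict (Ioi 0)) z = ∫ x in Ioi (0 : ℝ), (x : ℂ) ^ z ∂ρ := by
  refine setIntegral_congr_fun measurableSet_Ioi fun x hx => ?_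
  have hx : 0 < x := hx
  rw [Complex.cpow_def_of_ne_zero (by exact_mod_cast hx.ne'), Complex.ofReal_log hx.le, mul_comm]

/-- As 0^z = 0 for z ≠ 0, an atom at the origin does not contribute. -/
theorem momentTransform_eq_complexMGF (ρ : Measure ℝ) {z : ℂ} (hz : z ≠ 0) :
    momentTransform ρ z = ProbabilityTheory.complexMGF Real.log (ρ.restrict (Ioi 0)) z := by
  rw [complexMGF_log_restrict, momentTransform]
  refine setIntegral_eq_of_subset_of_forall_sdiff_eq_zero measurableSet_Ici Ioi_subset_Ici_self
    fun x hx => ?_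
  have : x = 0 := le_antisymm (not_lt.1 hx.2) hx.1
  simp [this, hz]

open ProbabilityTheory in
theorem IsBergUrbanik.momentTransform_eq {φ : BernsteinFunction}
    (hφ : ∃ u : ℝ, 0 ≤ u ∧ φ.toFun u ≠ 0) {ν : ℝ≥0 → Measure ℝ} (hν : IsBergUrbanik φ ν) (t : ℝ≥0)
    {z : ℂ} (hz : -1 < z.re) :
    IntegrableOn (fun x : ℝ => (x : ℂ) ^ z) (Ici 0) (ν t) ∧
      momentTransform (ν t) z = φ.WPow t (z + 1) := by
  obtain ⟨κ, hκ, htr⟩ := hν.transform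
  have := hν.prob t
  set m := (ν t).restrict (Ioi 0) with hm
  set h : ℂ → ℂ := fun z => Complex.exp ((t : ℝ) * φ.logW (z + 1)) with hh
  have hmgf {z : ℂ} (hz : 0 < z.re) :
      complexMGF Real.log m z = Complex.exp ((t : ℝ) * φ.Psi κ z) := by
    rw [← htr t z hz, momentTransform_eq_complexMGF]
    rintro rfl
    simp at hz
  -- A divergent integral would take the default value 0, but it equals an exponential.
  have hset : Ioi 0 ⊆ integrableExpSet Real.log m := fun s hs => by
    by_contra hcon
    refine Complex.exp_ne_zero _ ((hmgf (z := s) hs).symm.trans (complexMGF_undef (by fun_prop) ?_))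
    simpa [integrableExpSet] using hcon
  have hint : Ioi 0 ⊆ interior (integrableExpSet Real.log m) := interior_maximal hset isOpen_Ioi
  have hopen : IsOpen {z : ℂ | -1 < z.re} := isOpen_lt continuous_const Complex.continuous_re
  have hana : AnalyticOnNhd ℂ h {z : ℂ | -1 < z.re} := fun z hz => by
    have : AnalyticAt ℂ (fun z => φ.logW (z + 1)) z :=
      AnalyticAt.fun_comp_of_eq (φ.analyticOnNhd_logW hφ (z + 1)
        (show 0 < (z + 1).re by simp; linarith [show -1 < z.re from hz])) (by fun_prop) rfl
    fun_prop
  have heq : EqOn (complexMGF Real.log m) h rightHalfPlane := by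
    refine AnalyticOnNhd.eqOn_rightHalfPlane_of_Ioo
      (fun z hz => analyticAt_complexMGF (hint hz)) (hana.mono fun z hz => ?_) zero_le_one
      one_lt_two fun x hx _ => ?_
    · exact (neg_one_lt_zero.trans hz : -1 < z.re)
    · rw [hmgf (by simpa using zero_lt_one.trans hx), hκ.Psi_ofReal hφ hx.le]
  have heq1 {w : ℂ} (hw : 0 < w.re) : complexMGF Real.log m =ᶠ[𝓝 w] h :=
    heq.eventuallyEq_of_mem (isOpen_rightHalfPlane.mem_nhds hw)
  have hset' : Ioi (-1) ⊆ integrableExpSet Real.log m := fun s hs => by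
    rcases lt_or_ge 0 s with h0 | h0
    · exact hset h0
    · have hs : -1 < s := hs
      -- The disc of radius 2 about 1 lies in Re z > -1 and contains all of (-1, 0].
      have := mem_integrableExpSet_of_differentiableOn (a := 1) (r := 2) (s := s - 1)
        (hint (mem_Ioi.2 one_pos)) (hana.differentiableOn.mono fun w hw => ?_) (heq1 (by simp))
        (by rw [abs_lt]; constructor <;> linarith)
      · simpa using this
      · have := (Complex.abs_re_le_norm (w - 1)).trans_lt (by simpa [dist_eq_norm] using hw)
        have := (abs_lt.1 this).1
        simp only [Complex.sub_re, Complex.one_re] at this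
        show -1 < w.re
        linarith
  have hint' : Ioi (-1) ⊆ interior (integrableExpSet Real.log m) := interior_maximal hset' isOpen_Ioi
  have heq' : EqOn (complexMGF Real.log m) h {z : ℂ | -1 < z.re} :=
    AnalyticOnNhd.eqOn_of_preconnected_of_eventuallyEq
      (fun z hz => analyticAt_complexMGF (hint' hz)) hana
      (convex_halfSpace_re_gt (-1)).isPreconnected (z₀ := 1) (by simp) (heq1 (by simp))
  -- At z = 0 the continued identity gives ν_t mass W(1)^t = 1 on (0, ∞), so there is no atom at the
  -- origin.
  have hmass : m.real univ = 1 := by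
    have := heq' (show (0 : ℂ) ∈ {z : ℂ | -1 < z.re} by simp)
    simpa [complexMGF, hh, φ.logW_one hφ] using this
  have hIic : ν t (Iic 0) = 0 := by
    have h1 : (ν t).real (Ioi 0) = 1 := by simpa [hm, measureReal_def] using hmass
    rw [← compl_Ioi, prob_compl_eq_zero_iff measurableSet_Ioi]
    rwa [measureReal_def, ENNReal.toReal_eq_one_iff] at h1
  have hrestrict : (ν t).restrict (Ici 0) = m := by
    refine Measure.restrict_congr_set ?_
    have : ∀ᵐ x ∂(ν t), 0 < x := by
      rw [ae_iff]; simpa [Iic] using hIic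
    filter_upwards [this] with x hx
    exact propext ⟨fun _ => hx, fun _ => hx.le⟩
  constructor
  · rw [IntegrableOn, hrestrict]
    refine (integrable_cexp_mul_of_re_mem_integrableExpSet (by fun_prop)
      (hset' hz)).congr ?_
    filter_upwards [ae_restrict_mem measurableSet_Ioi] with x hx
    have hx : 0 < x := hx
    rw [Complex.cpow_def_of_ne_zero (by exact_mod_cast hx.ne'), Complex.ofReal_log hx.le, mul_comm]
  · rw [momentTransform, hrestrict, ← complexMGF_log_restrict, ← hm, heq' hz,
      φ.WPow_eq hφ _ (by simp; linarith)]

theorem mainTheorem7 (φ : BernsteinFunction) (hφ : ∃ u : ℝ, 0 ≤ u ∧ φ.toFun u ≠ 0) :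
    -- the limit, the product and the logarithm defining `W_φ` and `W_φ^t` exist
    Tendsto φ.gammaSeq atTop (𝓝 φ.gammaConst) ∧
    (∀ z ∈ rightHalfPlane, Summable fun k : ℕ => ‖φ.factor (k + 1) z - 1‖) ∧
    IsLogBranch φ.W (logBranch φ.W) ∧
    -- the moment transform of the Berg-Urbanik semigroup
    (∀ ν : ℝ≥0 → Measure ℝ, IsBergUrbanik φ ν → ∀ t : ℝ≥0, 0 < t → ∀ z : ℂ, -1 < z.re →
      IntegrableOn (fun x : ℝ => (x : ℂ) ^ z) (Ici 0) (ν t) ∧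
      momentTransform (ν t) z = φ.WPow t (z + 1)) ∧
    -- analyticity and the functional equation
    (∀ t : ℝ, 0 < t →
      AnalyticOnNhd ℂ (φ.WPow t) rightHalfPlane ∧
      (∀ z ∈ rightHalfPlane, φ.WPow t (z + 1) = φ.extPow t z * φ.WPow t z) ∧
      φ.WPow t 1 = 1) ∧
    -- `W_φ` is positive-definite, and the only such analytic solution
    IsPosDefOnImag (fun s => φ.W (1 + s)) ∧
    (∀ G : ℂ → ℂ, AnalyticOnNhd ℂ G rightHalfPlane → IsPosDefOnImag (fun s => G (1 + s)) →
      (∀ z ∈ rightHalfPlane, G (z + 1) = φ.ext z * G z) → G 1 = 1 →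
      EqOn G φ.W rightHalfPlane) :=
  ⟨φ.tendsto_gammaSeq hφ, fun _ hz => φ.summable_norm_factor_sub_one hφ (le_of_lt hz),
    (φ.isLogBranch_logW hφ).logBranch, fun _ hν t _ _ hz => hν.momentTransform_eq hφ t hz,
    fun t _ => ⟨φ.analyticOnNhd_WPow hφ t, fun _ hz => φ.WPow_add_one hφ t hz, φ.WPow_one hφ t⟩,
    φ.isPosDefOnImag_W hφ, fun _ hG hpd hfe h1 => φ.eqOn_W hφ hG hpd hfe h1⟩
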